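/- Let $\mathfrak g$ be a finite-dimensional simple complex Lie algebra with Cartan subalgebra $\mathfrak h$, a base $\alpha_1,\dots,\alpha_r$ of its root system, Chevalley generators $e_i,f_i$ ($1\le i\le r$), highest root $\theta$, and Coxeter number $h=1+\mathrm{ht}(\theta)$; let $\rho^\vee\in\mathfrak h$ be half the sum of the positive coroots. Let $E_0\neq 0$ lie in the lowest root space $\mathfrak g_{-\theta}$ and put $\Lambda_{1,z}=\sum_{i=1}^r e_i+zE_0$. Fix a faithful $n$-dimensional representation $\mathfrak g\hookrightarrow\mathfrak{gl}_n(\mathbb C)$, through which $\mathfrak g(\!(1/z)\!)$ acts on $\mathbb C(\!(1/z)\!)^n$. An element of $\mathfrak g\otimes\mathbb C[z,z^{-1}]$ has principal degree $d$ if for every $m$ its coefficient $x_m$ of $z^m$ satisfies $[\rho^\vee,x_m]=(d-hm)\,x_m$. Let $Gr_n$ be the set of complex subspaces $V\subseteq\mathbb C(\!(1/z)\!)^n$ such that $zV\subseteq V$ and the projection $V\to\mathbb C[z]^n$ (dropping the negative powers of $z$) is an isomorphism, and let the big cell $Gr_n(\mathfrak g^{(1)})$ be the set of those $V\in Gr_n$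 of the form $V=\exp(A)\,\mathbb C[z]^n$ with $A\in z^{-1}\mathfrak g[\![z^{-1}]\!]$. All infinite sums and exponentials are taken coefficientwise in powers of $z$. (a) For every $H\in\mathfrak h$ there are elements $V_i\in\mathfrak g\otimes\mathbb C[z,z^{-1}]$ of principal degree $i$, for $i<0$, such that the sum $\sum_{i<0}V_i$ and $\mu=\exp\bigl(\sum_{i<0}V_i\bigr)$ are well defined, $\mu$ is invertible, and, as operators on $\mathbb C(\!(1/z)\!)^n$, $$\mu^{-1}\Bigl(\partial_z+\frac Hz+\Lambda_{1,z}\Bigr)\mu=\partial_z+\Lambda_{1,z};$$ moreover $V=\mu\,\mathbb C[z]^n$ is a point of the big cell $Gr_n(\mathfrak g^{(1)})$ and $$\Bigl(\partial_z+\frac Hz+\Lambda_{1,z}\Bigr)V\subseteq V.$$ (b) In particular $\rho^\vee$ is not rigid under deformations inside $\mathfrak h$: for every $D\in\mathfrak h$ there is a point $V$ of $Gr_n(\mathfrak g^{(1)})$ with $$\Bigl(\partial_z+\frac{\rho^\vee+D}{hz}+\Lambda_{1,z}\Bigr)V\subseteq V.$$ -/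

import Mathlib

open LieAlgebra LieAlgebra.IsKilling Filter

attribute [local instance] LieRing.ofAssociativeRing

noncomputable section

namespace DrinfeldSokolov

/-! ### Laurent series in `1/z`

The field `ℂ((1/z))` is `LaurentSeries ℂ` in the variable `1/z`: the coefficient of index `k`
is the coefficient of `z ^ (-k)`.  Likewise `HahnSeries ℤ 𝔤` is `𝔤((1/z))`. -/

/-- The field `ℂ((1/z))`. -/
abbrev K : Type := LaurentSeries ℂ

/-- The variable `z`. -/
def z : K := HahnSeries.single (-1 : ℤ) (1 : ℂ)

/-- The derivation `∂_z` of `ℂ((1/z))`; in terms of `w = 1/z` it is `-w² ∂_w`. -/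
def dzFun (f : K) : K := -(HahnSeries.single (2 : ℤ) (1 : ℂ) * LaurentSeries.hasseDeriv ℂ 1 f)

theorem dzFun_coeff (f : K) (m : ℤ) :
    (dzFun f).coeff (-m) = ((m + 1 : ℤ) : ℂ) * f.coeff (-(m + 1)) := by
  have h : (HahnSeries.single (2 : ℤ) (1 : ℂ) * LaurentSeries.hasseDeriv ℂ 1 f).coeff
      ((-m - 2) + 2) = 1 * (LaurentSeries.hasseDeriv ℂ 1 f).coeff (-m - 2) :=
    HahnSeries.coeff_single_mul_add
  rw [show (-m - 2) + 2 = -m by ring] at h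
  rw [dzFun, HahnSeries.coeff_neg, h, LaurentSeries.hasseDeriv_coeff,
    show -m - 2 + ((1 : ℕ) : ℤ) = -(m + 1) by push_cast; ring, Ring.choose_one_right, zsmul_eq_mul]
  push_cast
  ring

/-- `∂_z` as a `ℂ`-linear map: the coefficient of `z ^ m` in `∂_z f` is `m + 1` times the
coefficient of `z ^ (m + 1)` in `f`, by `dzFun_coeff`. -/
def dz : K →ₗ[ℂ] K where
  toFun := dzFun
  map_add' f g := by
    ext k
    obtain ⟨m, rfl⟩ : ∃ m, k = -m := ⟨-k, by ring⟩
    simp only [HahnSeries.coeff_add, dzFun_coeff]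
    ring
  map_smul' c f := by
    ext k
    obtain ⟨m, rfl⟩ : ∃ m, k = -m := ⟨-k, by ring⟩
    simp only [HahnSeries.coeff_smul, dzFun_coeff, smul_eq_mul, RingHom.id_apply]
    ring

/-- A series `∑ₖ f k` of Laurent series in `1/z` has sum `s`, coefficient by coefficient: for every
power of `z`, the coefficient of the partial sums is eventually equal to that of `s`. -/
def IsFormalSum {M : Type*} [AddCommMonoid M] (f : ℕ → HahnSeries ℤ M) (s : HahnSeries ℤ M) :
    Prop :=
  ∀ m : ℤ, ∀ᶠ N in atTop, (∑ k ∈ Finset.range N, f k).coeff m = s.coeff m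

section Grassmannian

variable {n : ℕ}

/-- `μ = exp X = ∑ₖ X ^ k / k!` for matrices over `ℂ((1/z))`. -/
def IsFormalExp (X μ : Matrix (Fin n) (Fin n) K) : Prop :=
  ∀ i j, IsFormalSum (fun k : ℕ ↦ (((k.factorial : ℂ)⁻¹ • X ^ k) i j : K)) (μ i j)

/-- A matrix over `ℂ((1/z))` as an operator on `ℂ((1/z))ⁿ`. -/
def matOp (M : Matrix (Fin n) (Fin n) K) : (Fin n → K) →ₗ[ℂ] (Fin n → K) where
  toFun v := M.mulVec v
  map_add' u v := M.mulVec_add u v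
  map_smul' c v := by
    have hc : ∀ u : Fin n → K, c • u = (HahnSeries.C c : K) • u := fun u ↦ by
      ext i k
      simp
    simp only [hc, Matrix.mulVec_smul, RingHom.id_apply]

/-- The operator `∂_z + M` on `ℂ((1/z))ⁿ`. -/
def connection (M : Matrix (Fin n) (Fin n) K) : (Fin n → K) →ₗ[ℂ] (Fin n → K) :=
  dz.compLeft (Fin n) + matOp M

/-- `ℂ[z]ⁿ` inside `ℂ((1/z))ⁿ`: no negative power of `z` occurs. -/
def Hplus (n : ℕ) : Submodule ℂ (Fin n → K) where
  carrier := {v | ∀ i, ∀ k : ℤ, 0 < k → (v i).coeff k = 0}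
  add_mem' {u v} hu hv i k hk := by
    simp [hu i k hk, hv i k hk]
  zero_mem' i k _ := by simp
  smul_mem' c v hv i k hk := by
    simp [hv i k hk]

/-- The projection `ℂ((1/z))ⁿ → ℂ[z]ⁿ` that drops all negative powers of `z`. -/
def projPlus (v : Fin n → K) : Fin n → K :=
  fun i ↦ HahnSeries.truncLT (1 : ℤ) (v i)

/-- `Gr_n`: the complex subspaces `V` of `ℂ((1/z))ⁿ` with `zV ⊆ V` that are mapped isomorphically
onto `ℂ[z]ⁿ` by the projection. -/
def Gr (n : ℕ) : Set (Submodule ℂ (Fin n → K)) :=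
  {V | (∀ v ∈ V, z • v ∈ V) ∧ Set.BijOn projPlus (V : Set (Fin n → K)) (Hplus n)}

/-- `(∂_z + M) V ⊆ V`. -/
def Stabilizes (M : Matrix (Fin n) (Fin n) K) (V : Submodule ℂ (Fin n → K)) : Prop :=
  ∀ v ∈ V, connection M v ∈ V

end Grassmannian

section LieAlgebra

variable {𝔤 : Type*} [LieRing 𝔤] [LieAlgebra ℂ 𝔤] {n : ℕ}

/-- The action of `x ∈ 𝔤((1/z))` on `ℂ((1/z))ⁿ` through an `n`-dimensional representation `π`
of `𝔤`, as a matrix: `π` is applied to each coefficient. -/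
def act (π : 𝔤 →ₗ⁅ℂ⁆ Matrix (Fin n) (Fin n) ℂ) (x : HahnSeries ℤ 𝔤) :
    Matrix (Fin n) (Fin n) K :=
  Matrix.of fun i j ↦ x.map ((Matrix.entryLinearMap ℂ ℂ i j) ∘ₗ (π : 𝔤 →ₗ[ℂ] _))

/-- The big cell `Gr_n(𝔤⁽¹⁾)`: the points `exp(A) ℂ[z]ⁿ` of `Gr_n` with `A` in the (completed)
negative part `z⁻¹ 𝔤[[z⁻¹]]` of the loop algebra, for the homogeneous gradation. -/
def bigCell (π : 𝔤 →ₗ⁅ℂ⁆ Matrix (Fin n) (Fin n) ℂ) : Set (Submodule ℂ (Fin n → K)) :=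
  {V | V ∈ Gr n ∧ ∃ (A : HahnSeries ℤ 𝔤) (γ : Matrix (Fin n) (Fin n) K),
    (∀ k ≤ 0, A.coeff k = 0) ∧ IsFormalExp (act π A) γ ∧ V = (Hplus n).map (matOp γ)}

variable [FiniteDimensional ℂ 𝔤] [LieAlgebra.IsSimple ℂ 𝔤]
  {𝔥 : LieSubalgebra ℂ 𝔤} [𝔥.IsCartanSubalgebra]

/-- Chevalley generators of `𝔤` relative to a base of its root system: `eᵢ` and `fᵢ` are root
vectors for `αᵢ` and `-αᵢ`, and `[eᵢ, fᵢ] = αᵢ^∨`. -/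
structure ChevalleyGenerators (b : (rootSystem 𝔥).Base) where
  /-- The positive generators. -/
  e : b.support → 𝔤
  /-- The negative generators. -/
  f : b.support → 𝔤
  e_mem (i : b.support) : e i ∈ rootSpace 𝔥 (i.1.1 : 𝔥 → ℂ)
  f_mem (i : b.support) : f i ∈ rootSpace 𝔥 (-(i.1.1 : 𝔥 → ℂ))
  lie_e_f (i : b.support) : ⁅e i, f i⁆ = ((rootSystem 𝔥).coroot i.1 : 𝔤)

/-- `θ` is the highest root: `θ - β` is a sum of simple roots for every root `β`. -/
def IsHighestRoot (b : (rootSystem 𝔥).Base) (θ : 𝔥.root) : Prop :=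
  ∀ β : 𝔥.root, (rootSystem 𝔥).root θ - (rootSystem 𝔥).root β ∈
    AddSubmonoid.closure ((rootSystem 𝔥).root '' (b.support : Set 𝔥.root))

/-- The Coxeter number: one plus the height of the highest root `θ`. -/
def coxeterNumber (b : (rootSystem 𝔥).Base) (θ : 𝔥.root) : ℤ :=
  b.height θ + 1

open Classical in
/-- `ρ^∨`: half the sum of the positive coroots. -/
def rhoCheck (b : (rootSystem 𝔥).Base) : 𝔥 :=
  (1 / 2 : ℂ) • ∑ β : 𝔥.root with b.IsPos β, (rootSystem 𝔥).coroot β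

/-- `x` is an element of `𝔤 ⊗ ℂ[z, z⁻¹]` of principal degree `d`.  The principal gradation gives
every affine Chevalley generator `eᵢ` degree `1`, so a root vector of height `j` times `z ^ m` has
degree `j + h m`, and `𝔥 z ^ m` has degree `h m`; heights are the eigenvalues of `ad ρ^∨`. -/
def IsPrincipalDegree (b : (rootSystem 𝔥).Base) (θ : 𝔥.root) (d : ℤ) (x : HahnSeries ℤ 𝔤) :
    Prop :=
  x.support.Finite ∧ ∀ m : ℤ, ⁅(rhoCheck b : 𝔤), x.coeff (-m)⁆ =
    ((d - coxeterNumber b θ * m : ℤ) : ℂ) • x.coeff (-m)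

/-- The cyclic element `Λ_{1,z} = ∑ᵢ eᵢ + z E₀`. -/
def cyclicElement {b : (rootSystem 𝔥).Base} (c : ChevalleyGenerators b) (E₀ : 𝔤) :
    HahnSeries ℤ 𝔤 :=
  HahnSeries.single 0 (∑ i, c.e i) + HahnSeries.single (-1) E₀

/-- The element `H / z` of the loop algebra. -/
def overZ (H : 𝔤) : HahnSeries ℤ 𝔤 := HahnSeries.single 1 H

end LieAlgebra

end DrinfeldSokolov

end

/-! Grade the loop algebra principally: `Λ` has degree `1`, while `∂_z` lowers degree by `h` and
`H/z` has degree `-h`. The series `X = ∑ V_i` is built degree by degree so that `exp(-ad X)(∂_z +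
H/z + Λ) = ∂_z + Λ`. Multiplying by powers of `z` identifies each principal degree with the
corresponding residue class mod `h` of degrees in `𝔤`, and `ad Λ` becomes the adjoint action of `L =
∑ e_i + E₀` (`lie_lam_lift`), so every equation to be solved lives in `𝔤`.

Two facts about `L` are needed. First, `𝔤 = im ad L ⊕ ker ad L` (`exists_eq_lie_cyc_add`), since a
semisimple part of `L` is forced by the `ℤ/h` symmetry to be a nonzero multiple of `L`. Second,
elements of `ker ad L` have no component in degree zero. By invariance of the Killing form, `im ad
L` is the orthogonal of `ker ad L`; hence it contains `𝔥`, and also `[H, s]` for `H ∈ 𝔥` and `s ∈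
ker ad L` (`exists_lie_cyc_eq_lie`).

The first correction solves `[Λ, X] = -H/z`. Afterwards an error in degree `-N` has a part in `im ad
Λ`, removed by a term of degree `-N-1`, and a part `s` in the centralizer, which `ad Λ` cannot
reach. It is removed by `∂_z`: a multiple of the lift of `s` to degree `d = h - N` commutes with
`Λ`, and its `z`-derivative is a nonzero multiple of `s` plus a multiple of `[ρ^∨, s]`, which lies
in the image (`exists_dressing_step`). The division by `d` is legitimate because `d < 0`.

The limit `X` has degree at most `-h-1`, hence contains only negative powers of `z`. So `μ = exp X =
1 + O(1/z)` is invertible and `μ ℂ[z]ⁿ` lies in the big cell. Since `∂_z + Λ` preserves `ℂ[z]ⁿ`, its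
conjugate preserves `μ ℂ[z]ⁿ`. Part (b) is the case `H = (ρ^∨ + D)/h`. -/

noncomputable section

namespace DrinfeldSokolov

/-! ### Heights as eigenvalues of `ρ^∨`. -/

section PrincipalGrading

open Module

-- The reflection in the simple root `i` permutes the other positive roots and changes the sign of
-- the pairing with `i`; their contributions cancel and only `β = i` remains. This is `αᵢ(2ρ^∨) =
-- 2`.
open Classical in
theorem sum_isPos_pairing_eq_two {ι R M N : Type*} [Fintype ι] [CommRing R] [IsDomain R]
    [CharZero R]
    [AddCommGroup M] [Module R M] [AddCommGroup N] [Module R N] {Q : RootPairing ι R M N}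
    [Q.IsCrystallographic] [Q.IsReduced] (b : Q.Base) {i : ι} (hi : i ∈ b.support) :
    ∑ β : ι with b.IsPos β, Q.pairing i β = 2 := by
  have hmaps : ∀ β ∈ Finset.univ.filter (fun β ↦ b.IsPos β ∧ β ≠ i),
      Q.reflectionPerm i β ∈ Finset.univ.filter (fun β ↦ b.IsPos β ∧ β ≠ i) := by
    intro β hβ
    simp only [Finset.mem_filter, Finset.mem_univ, true_and] at hβ ⊢
    refine ⟨hβ.1.reflectionPerm hi hβ.2, fun h ↦ ?_⟩
    have h3 : β = Q.reflectionPerm i i := by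
      rw [← Q.reflectionPerm_self i β, h]
    have h5 := hβ.1
    have h6 : b.height (Q.reflectionPerm i i) = - b.height i := b.height_reflectionPerm_self i
    rw [RootPairing.Base.isPos_iff, h3, h6, RootPairing.Base.height_one_of_mem_support hi] at h5
    omega
  have key : ∑ β : ι with (b.IsPos β ∧ β ≠ i), Q.pairing i β = 0 := by
    have h1 : ∑ β : ι with (b.IsPos β ∧ β ≠ i), Q.pairing i β =
        ∑ β : ι with (b.IsPos β ∧ β ≠ i), -Q.pairing i β := by
      refine Finset.sum_nbij' (Q.reflectionPerm i) (Q.reflectionPerm i) hmaps hmaps ?_ ?_ ?_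
      · intro β _; exact Q.reflectionPerm_self i β
      · intro β _; exact Q.reflectionPerm_self i β
      · intro β _
        rw [Q.pairing_reflectionPerm, Q.pairing_reflectionPerm_self_left, neg_neg]
    rw [Finset.sum_neg_distrib] at h1
    exact self_eq_neg.mp h1
  have : (Finset.univ.filter fun β : ι ↦ b.IsPos β) =
      insert i (Finset.univ.filter fun β : ι ↦ b.IsPos β ∧ β ≠ i) := by
    ext β
    simp only [Finset.mem_filter, Finset.mem_univ, true_and, Finset.mem_insert]
    by_cases h : β = i
    · subst h; simpa using RootPairing.Base.isPos_of_mem_support hi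
    · simp [h]
  rw [this, Finset.sum_insert (by simp), key]
  simp

variable {𝔤 : Type*} [LieRing 𝔤] [LieAlgebra ℂ 𝔤] [FiniteDimensional ℂ 𝔤] [LieAlgebra.IsSimple ℂ 𝔤]
  {𝔥 : LieSubalgebra ℂ 𝔤} [𝔥.IsCartanSubalgebra] (b : (rootSystem 𝔥).Base)

theorem root_apply_rhoCheck_of_mem_support {i : 𝔥.root} (hi : i ∈ b.support) :
    (rootSystem 𝔥).root i (rhoCheck b) = 1 := by
  have h := sum_isPos_pairing_eq_two b hi
  rw [rhoCheck, map_smul, map_sum]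
  calc _ = (1 / 2 : ℂ) • (2 : ℂ) := by rw [← h]; rfl
    _ = 1 := by norm_num

theorem root_apply_rhoCheck (β : 𝔥.root) :
    (rootSystem 𝔥).root β (rhoCheck b) = (b.height β : ℂ) := by
  obtain ⟨f, -, -, hf⟩ := b.exists_root_eq_sum_int β
  rw [RootPairing.Base.height_eq_sum hf, hf, LinearMap.sum_apply]
  push_cast
  refine Finset.sum_congr rfl fun j hj ↦ ?_
  rw [LinearMap.smul_apply, root_apply_rhoCheck_of_mem_support b hj]
  simp

/-- Evaluation at `ρ^∨` counts the simple roots in a sum, and the count is zero only for the empty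
sum; apply this to `θ - β`. -/
theorem height_le_of_isHighestRoot {θ : 𝔥.root} (hθ : IsHighestRoot b θ) (β : 𝔥.root) :
    b.height β ≤ b.height θ ∧ (b.height β = b.height θ → β = θ) := by
  have key : ∀ x ∈ AddSubmonoid.closure ((rootSystem 𝔥).root '' (b.support : Set 𝔥.root)),
      ∃ k : ℕ, x (rhoCheck b) = k ∧ (k = 0 → x = 0) := by
    intro x hx
    induction hx using AddSubmonoid.closure_induction with
    | mem x hx =>
      obtain ⟨i, hi, rfl⟩ := hx
      exact ⟨1, by simpa using root_apply_rhoCheck_of_mem_support b hi, by simp⟩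
    | zero => exact ⟨0, by simp⟩
    | add x y _ _ hx hy =>
      obtain ⟨k, hk, hk'⟩ := hx
      obtain ⟨l, hl, hl'⟩ := hy
      refine ⟨k + l, by simp [hk, hl], fun h ↦ ?_⟩
      rw [hk' (by omega), hl' (by omega), add_zero]
  obtain ⟨k, hk, hk'⟩ := key _ (hθ β)
  rw [LinearMap.sub_apply, root_apply_rhoCheck, root_apply_rhoCheck] at hk
  have hk2 : b.height θ - b.height β = k := by exact_mod_cast hk
  refine ⟨by omega, fun h ↦ ?_⟩
  have := hk' (by omega)
  exact ((rootSystem 𝔥).root.injective (sub_eq_zero.mp this)).symm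

theorem height_neg (β : 𝔥.root) : ∃ β' : 𝔥.root, b.height β' = - b.height β ∧
    (rootSystem 𝔥).root β' = -(rootSystem 𝔥).root β :=
  ⟨(rootSystem 𝔥).reflectionPerm β β, b.height_reflectionPerm_self β,
    by rw [RootPairing.root_reflectionPerm, RootPairing.reflection_apply_self]⟩

theorem two_le_coxeterNumber {θ : 𝔥.root} (hθ : IsHighestRoot b θ) : 2 ≤ coxeterNumber b θ := by
  have hne : b.support.Nonempty := by
    have : Nonempty 𝔥.root := ⟨θ⟩
    exact b.support_nonempty
  obtain ⟨i, hi⟩ := hne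
  have := (height_le_of_isHighestRoot b hθ i).1
  rw [RootPairing.Base.height_one_of_mem_support hi] at this
  unfold coxeterNumber
  omega

theorem abs_height_lt {θ : 𝔥.root} (hθ : IsHighestRoot b θ) (β : 𝔥.root) :
    -coxeterNumber b θ < b.height β ∧ b.height β < coxeterNumber b θ := by
  obtain ⟨β', h1, -⟩ := height_neg b β
  have h2 := (height_le_of_isHighestRoot b hθ β).1
  have h3 := (height_le_of_isHighestRoot b hθ β').1
  unfold coxeterNumber
  omega

theorem mem_support_of_height_eq_one {β : 𝔥.root} (hβ : b.height β = 1) : β ∈ b.support := by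
  classical
  obtain ⟨f, hf, hpn, hs⟩ := b.exists_root_eq_sum_int β
  have hh := RootPairing.Base.height_eq_sum hs
  rw [hβ] at hh
  rcases hpn with hp | hn
  · have hp' : ∀ j, 0 ≤ f j := fun j ↦ hp.le j
    obtain ⟨j, hj, hj0⟩ : ∃ j ∈ b.support, 1 ≤ f j := by
      by_contra! hcon
      have : ∑ j ∈ b.support, f j ≤ 0 := Finset.sum_nonpos fun j hj ↦ by
        have := hcon j hj; omega
      omega
    have hrest : ∑ k ∈ b.support.erase j, f k = 1 - f j := by
      rw [hh, ← Finset.add_sum_erase _ _ hj]; ring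
    have h0 : 0 ≤ ∑ k ∈ b.support.erase j, f k := Finset.sum_nonneg fun k _ ↦ hp' k
    have hz : ∀ k ∈ b.support.erase j, f k = 0 :=
      (Finset.sum_eq_zero_iff_of_nonneg fun k _ ↦ hp' k).mp (by omega)
    have hfj : f j = 1 := by omega
    have : (rootSystem 𝔥).root β = (rootSystem 𝔥).root j := by
      rw [hs, ← Finset.add_sum_erase _ _ hj, hfj,
        Finset.sum_eq_zero fun k hk ↦ by rw [hz k hk, zero_smul]]
      simp
    rwa [(rootSystem 𝔥).root.injective this]
  · have : ∑ j ∈ b.support, f j ≤ 0 := Finset.sum_nonpos fun j _ ↦ hn.le j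
    omega

end PrincipalGrading

/-! ### The cyclic element in an abstract graded Lie algebra. -/

section CyclicGrading

/-- A Lie algebra with an element `ρ` whose adjoint action is diagonalizable with integer
eigenvalues of absolute value less than `h`, and elements `e`, `E` of degree `1` and `1 - h`. -/
structure CyclicGrading (𝔤 : Type*) [LieRing 𝔤] [LieAlgebra ℂ 𝔤] where
  /-- The bound on the degrees. -/
  h : ℤ
  two_le_h : 2 ≤ h
  /-- The grading element. -/
  ρ : 𝔤
  /-- The projection onto the component of a given degree. -/
  P : ℤ → 𝔤 →ₗ[ℂ] 𝔤
  lie_P (f : ℤ) (x : 𝔤) : ⁅ρ, P f x⁆ = (f : ℂ) • P f x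
  P_self (f : ℤ) (x : 𝔤) : ⁅ρ, x⁆ = (f : ℂ) • x → P f x = x
  P_of_ne (f a : ℤ) (x : 𝔤) : ⁅ρ, x⁆ = (a : ℂ) • x → a ≠ f → P f x = 0
  P_of_le (f : ℤ) (x : 𝔤) : f ≤ -h ∨ h ≤ f → P f x = 0
  sum_P (x : 𝔤) : ∑ f ∈ Finset.Ioo (-h) h, P f x = x
  /-- The sum of the simple root vectors. -/
  e : 𝔤
  lie_e : ⁅ρ, e⁆ = e
  /-- The lowest root vector. -/
  E : 𝔤
  lie_E : ⁅ρ, E⁆ = ((1 - h : ℤ) : ℂ) • E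
  E_ne_zero : E ≠ 0
  -- These three fields isolate what the root system must supply: the lowest component is a line,
  -- `ad e` is injective in degree zero, and no nonzero element of degree one commutes with both `e`
  -- and `E`.
  exists_smul_E (y : 𝔤) : ⁅ρ, y⁆ = ((1 - h : ℤ) : ℂ) • y → ∃ c : ℂ, y = c • E
  eq_zero_of_degree_zero (H : 𝔤) : ⁅ρ, H⁆ = 0 → ⁅e, H⁆ = 0 → H = 0
  eq_zero_of_degree_one (y : 𝔤) : ⁅ρ, y⁆ = y → ⁅e, y⁆ = 0 → ⁅E, y⁆ = 0 → y = 0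

namespace CyclicGrading

variable {𝔤 : Type*} [LieRing 𝔤] [LieAlgebra ℂ 𝔤] (G : CyclicGrading 𝔤)

/-- The cyclic element at `z = 1`. -/
def cyc : 𝔤 := G.e + G.E

theorem hom_induction {p : 𝔤 → Prop} (hom : ∀ (f : ℤ) (x : 𝔤), ⁅G.ρ, x⁆ = (f : ℂ) • x → p x)
    (add : ∀ x y, p x → p y → p (x + y)) (x : 𝔤) : p x := by
  rw [← G.sum_P x]
  refine Finset.sum_induction _ p add (hom 0 0 (by simp)) fun f _ ↦ hom f _ (G.lie_P f x)

theorem lie_rho_lie {a c : ℤ} {x y : 𝔤} (hx : ⁅G.ρ, x⁆ = (a : ℂ) • x)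
    (hy : ⁅G.ρ, y⁆ = (c : ℂ) • y) : ⁅G.ρ, ⁅x, y⁆⁆ = ((a + c : ℤ) : ℂ) • ⁅x, y⁆ := by
  rw [leibniz_lie, hx, hy, smul_lie, lie_smul, ← add_smul]
  push_cast
  rfl

theorem P_P (f a : ℤ) (x : 𝔤) : G.P f (G.P a x) = if a = f then G.P a x else 0 := by
  split_ifs with h
  · subst h; exact G.P_self _ _ (G.lie_P _ _)
  · exact G.P_of_ne _ _ _ (G.lie_P _ _) h

theorem P_lie {a : ℤ} {x : 𝔤} (hx : ⁅G.ρ, x⁆ = (a : ℂ) • x) (f : ℤ) (y : 𝔤) :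
    G.P f ⁅x, y⁆ = ⁅x, G.P (f - a) y⁆ := by
  induction y using G.hom_induction with
  | hom c y hy =>
    by_cases h : c = f - a
    · subst h
      rw [G.P_self _ _ hy, G.P_self]
      rw [G.lie_rho_lie hx hy, show a + (f - a) = f by ring]
    · rw [G.P_of_ne _ _ _ hy h, lie_zero, G.P_of_ne _ _ _ (G.lie_rho_lie hx hy)]
      omega
  | add x y hx hy => rw [lie_add, map_add, hx, hy, map_add, lie_add]

theorem lie_e' : ⁅G.ρ, G.e⁆ = ((1 : ℤ) : ℂ) • G.e := by rw [G.lie_e]; simp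

theorem P_lie_cyc (f : ℤ) (y : 𝔤) :
    G.P f ⁅G.cyc, y⁆ = ⁅G.e, G.P (f - 1) y⁆ + ⁅G.E, G.P (f - 1 + G.h) y⁆ := by
  rw [cyc, add_lie, map_add, G.P_lie G.lie_e', G.P_lie G.lie_E,
    show f - (1 - G.h) = f - 1 + G.h by ring]

/-- In degree one, `[L, s]` has the component `[e, s₀]` alone, since the other candidate `[E, s_h]`
involves the vanishing degree `h`. -/
theorem P_zero_of_lie_cyc {s : 𝔤} (hs : ⁅G.cyc, s⁆ = 0) : G.P 0 s = 0 := by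
  have h := G.P_lie_cyc 1 s
  have h0 := G.lie_P 0 s
  rw [hs, map_zero, sub_self, zero_add, G.P_of_le G.h _ (by right; rfl), lie_zero, add_zero] at h
  exact G.eq_zero_of_degree_zero _ (by simpa using h0) h.symm

/-- If `[L, u] = L`, the degree-one component forces `u₀ = -ρ`; the component of degree `1 - h` then
reads `E = (1 - h) E`, so `h E = 0`. -/
theorem cyc_ne_lie_cyc (u : 𝔤) : ⁅G.cyc, u⁆ ≠ G.cyc := by
  intro hu
  have hh := G.two_le_h
  have h1 := G.P_lie_cyc 1 u
  have h2 := G.P_lie_cyc (1 - G.h) u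
  rw [hu, cyc, map_add, G.P_self 1 _ G.lie_e', G.P_of_ne 1 _ _ G.lie_E (by omega), sub_self,
    zero_add, G.P_of_le G.h _ (by right; rfl), lie_zero, add_zero, add_zero] at h1
  rw [hu, cyc, map_add, G.P_self _ _ G.lie_E, G.P_of_ne _ _ _ G.lie_e' (by omega),
    G.P_of_le (1 - G.h - 1) _ (by left; omega), lie_zero, zero_add, zero_add,
    show 1 - G.h - 1 + G.h = 0 by ring] at h2
  have h0 := G.lie_P 0 u
  have h3 : G.P 0 u + G.ρ = 0 := by
    refine G.eq_zero_of_degree_zero _ ?_ ?_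
    · rw [lie_add, lie_self, h0]; simp
    · rw [lie_add, ← h1, ← lie_skew, G.lie_e]; simp
  rw [eq_neg_of_add_eq_zero_left h3, lie_neg, lie_skew, G.lie_E] at h2
  have h4 : ((G.h : ℤ) : ℂ) • G.E = 0 := by
    have : ((G.h : ℤ) : ℂ) • G.E = G.E - ((1 - G.h : ℤ) : ℂ) • G.E := by
      push_cast; module
    rw [this, ← h2, sub_self]
  rcases smul_eq_zero.mp h4 with h5 | h5
  · have : G.h = 0 := by exact_mod_cast h5
    omega
  · exact G.E_ne_zero h5

/-- The automorphism acting on the component of degree `f` by `ζ ^ f`. -/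
def rot (ζ : ℂ) : 𝔤 →ₗ[ℂ] 𝔤 := ∑ f ∈ Finset.Ioo (-G.h) G.h, (ζ ^ f) • G.P f

theorem rot_apply (ζ : ℂ) {f : ℤ} {x : 𝔤} (hx : ⁅G.ρ, x⁆ = (f : ℂ) • x) :
    G.rot ζ x = ζ ^ f • x := by
  have h : ∀ a ∈ Finset.Ioo (-G.h) G.h, (ζ ^ a • G.P a) x = ζ ^ f • G.P a x := by
    intro a _
    rw [LinearMap.smul_apply]
    by_cases ha : f = a
    · rw [ha]
    · rw [G.P_of_ne _ _ _ hx ha, smul_zero, smul_zero]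
  rw [rot, LinearMap.sum_apply, Finset.sum_congr rfl h, ← Finset.smul_sum, G.sum_P]

theorem rot_lie {ζ : ℂ} (hζ : ζ ≠ 0) (x y : 𝔤) : G.rot ζ ⁅x, y⁆ = ⁅G.rot ζ x, G.rot ζ y⁆ := by
  induction x using G.hom_induction with
  | hom a x hx =>
    induction y using G.hom_induction with
    | hom c y hy =>
      rw [G.rot_apply ζ hx, G.rot_apply ζ hy, G.rot_apply ζ (G.lie_rho_lie hx hy), smul_lie,
        lie_smul, smul_smul, zpow_add₀ hζ]
    | add y y' hy hy' => simp only [lie_add, map_add, hy, hy']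
  | add x x' hx hx' => simp only [add_lie, map_add, hx, hx']

theorem rot_surjective {ζ : ℂ} (hζ : ζ ≠ 0) : Function.Surjective (G.rot ζ) := by
  intro y
  induction y using G.hom_induction with
  | hom c y hy =>
    refine ⟨(ζ ^ c)⁻¹ • y, ?_⟩
    rw [map_smul, G.rot_apply ζ hy, smul_smul, inv_mul_cancel₀ (zpow_ne_zero _ hζ), one_smul]
  | add y y' hy hy' =>
    obtain ⟨x, rfl⟩ := hy
    obtain ⟨x', rfl⟩ := hy'
    exact ⟨x + x', map_add _ _ _⟩

theorem P_rot (ζ : ℂ) (f : ℤ) (x : 𝔤) : G.P f (G.rot ζ x) = ζ ^ f • G.P f x := by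
  induction x using G.hom_induction with
  | hom c y hy =>
    rw [G.rot_apply ζ hy, map_smul]
    by_cases h : c = f
    · rw [h]
    · rw [G.P_of_ne _ _ _ hy h, smul_zero, smul_zero]
  | add y y' hy hy' => simp only [map_add, hy, hy', smul_add]

theorem rot_cyc {ζ : ℂ} (hζ : ζ ^ G.h = 1) : G.rot ζ G.cyc = ζ • G.cyc := by
  have hζ0 : ζ ≠ 0 := by
    rintro rfl
    rw [zero_zpow _ (by have := G.two_le_h; omega)] at hζ
    exact zero_ne_one hζ
  rw [cyc, map_add, G.rot_apply ζ G.lie_e', G.rot_apply ζ G.lie_E, zpow_one, zpow_sub₀ hζ0, hζ,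
    zpow_one, div_one, smul_add]

/-- Subtracting the multiple of `L` with the same `E`-part leaves an element of pure degree one. Its
brackets with `e` and `E` lie in different degrees, so both vanish. -/
theorem eq_smul_cyc_of_degrees {s : 𝔤} (hs : ∀ f, f ≠ 1 → f ≠ 1 - G.h → G.P f s = 0)
    (hc : ⁅G.cyc, s⁆ = 0) : ∃ c : ℂ, s = c • G.cyc := by
  have hh := G.two_le_h
  obtain ⟨c, hcE⟩ := G.exists_smul_E _ (G.lie_P (1 - G.h) s)
  have hsum : s = G.P 1 s + c • G.E := by
    have hsub : ({1, 1 - G.h} : Finset ℤ) ⊆ Finset.Ioo (-G.h) G.h := by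
      intro f hf
      simp only [Finset.mem_insert, Finset.mem_singleton] at hf
      rw [Finset.mem_Ioo]
      omega
    conv_lhs => rw [← G.sum_P s]
    rw [← Finset.sum_subset hsub, Finset.sum_pair (by omega), hcE]
    intro f _ hf
    simp only [Finset.mem_insert, Finset.mem_singleton, not_or] at hf
    exact hs f hf.1 hf.2
  refine ⟨c, sub_eq_zero.mp ?_⟩
  set y := s - c • G.cyc with hy
  have hy1 : y = G.P 1 s - c • G.e := by
    rw [hy, cyc]; conv_lhs => rw [hsum]
    rw [smul_add]; abel
  have hyd : ⁅G.ρ, y⁆ = ((1 : ℤ) : ℂ) • y := by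
    rw [hy1, lie_sub, lie_smul, G.lie_P, G.lie_e]; simp
  have hyc : ⁅G.cyc, y⁆ = 0 := by rw [hy, lie_sub, hc, lie_smul, lie_self]; simp
  have h1 := G.P_lie_cyc 2 y
  have h2 := G.P_lie_cyc (2 - G.h) y
  rw [hyc, map_zero, show (2 : ℤ) - 1 = 1 by norm_num, G.P_self _ _ hyd,
    G.P_of_ne _ _ _ hyd (by omega), lie_zero, add_zero] at h1
  rw [hyc, map_zero, show 2 - G.h - 1 + G.h = 1 by ring, G.P_self _ _ hyd,
    G.P_of_ne _ _ _ hyd (by omega), lie_zero, zero_add] at h2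
  exact G.eq_zero_of_degree_one y (by simpa using hyd) h1.symm h2.symm

/-! ### Semisimplicity of the cyclic element and the image of its adjoint action. -/

section Killing

variable [FiniteDimensional ℂ 𝔤] [LieAlgebra.IsKilling ℂ 𝔤]

/-- By invariance and nondegeneracy, the orthogonal of `im ad L` is the centralizer of `L`; taking
orthogonals twice returns the image. -/
theorem _root_.LieAlgebra.exists_lie_eq_of_killingForm_eq_zero {L x : 𝔤}
    (hx : ∀ y, ⁅L, y⁆ = 0 → killingForm ℂ 𝔤 x y = 0) : ∃ u, ⁅L, u⁆ = x := by
  have hnd := LieAlgebra.IsKilling.killingForm_nondegenerate ℂ 𝔤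
  have hrefl : (killingForm ℂ 𝔤).IsRefl := (LieModule.traceForm_isSymm ℂ 𝔤 𝔤).isRefl
  have h : x ∈ (killingForm ℂ 𝔤).orthogonal ((killingForm ℂ 𝔤).orthogonal
      (LinearMap.range (LieAlgebra.ad ℂ 𝔤 L))) := by
    rw [LinearMap.BilinForm.mem_orthogonal_iff]
    intro y hy
    rw [LinearMap.BilinForm.mem_orthogonal_iff] at hy
    refine hrefl _ _ (hx y ?_)
    refine hnd.1 _ fun u ↦ ?_
    have h1 : killingForm ℂ 𝔤 ⁅L, u⁆ y = 0 := hy _ ⟨u, rfl⟩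
    rw [LieModule.traceForm_comm] at h1
    have h2 : ⁅L, y⁆ = -⁅y, L⁆ := (lie_skew _ _).symm
    rw [h2, map_neg, LinearMap.neg_apply, LieModule.traceForm_apply_lie_apply, h1, neg_zero]
  rw [LinearMap.BilinForm.orthogonal_orthogonal hnd hrefl] at h
  exact h

/-- If `ad L` were nilpotent, its product with any commuting `ad y` would be nilpotent and
traceless. Then `L` would be orthogonal to its centralizer, hence of the form `[L, u]`. -/
theorem not_isNilpotent_ad_cyc : ¬ IsNilpotent (LieAlgebra.ad ℂ 𝔤 G.cyc) := by
  intro hn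
  obtain ⟨u, hu⟩ := LieAlgebra.exists_lie_eq_of_killingForm_eq_zero (L := G.cyc) (x := G.cyc) <| by
    intro y hy
    rw [LieModule.traceForm_apply_apply]
    have hc : Commute (LieAlgebra.ad ℂ 𝔤 G.cyc) (LieAlgebra.ad ℂ 𝔤 y) := by
      rw [commute_iff_lie_eq, ← LieHom.map_lie, hy, map_zero]
    exact (LinearMap.isNilpotent_trace_of_isNilpotent (hc.isNilpotent_mul_right hn)).eq_zero
  exact G.cyc_ne_lie_cyc u hu

open Module.End in
/-- The semisimple part of `ad L` is inner. -/
theorem _root_.LieAlgebra.exists_semisimple_part (L : 𝔤) : ∃ s : 𝔤,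
    (∀ (μ : ℂ), ∀ y ∈ (LieAlgebra.ad ℂ 𝔤 L).maxGenEigenspace μ, ⁅s, y⁆ = μ • y) ∧
    IsNilpotent (LieAlgebra.ad ℂ 𝔤 L - LieAlgebra.ad ℂ 𝔤 s) := by
  obtain ⟨N, -, S, hS₀, hN, hS, hSN⟩ := (LieAlgebra.ad ℂ 𝔤 L).exists_isNilpotent_isSemisimple
  replace hS₀ : Commute (LieAlgebra.ad ℂ 𝔤 L) S := Algebra.commute_of_mem_adjoin_self hS₀
  rw [eq_sub_of_add_eq hSN.symm] at hN
  have aux (μ : ℂ) (y : 𝔤) (hy : y ∈ (LieAlgebra.ad ℂ 𝔤 L).maxGenEigenspace μ) : S y = μ • y := by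
    rw [maxGenEigenspace_eq] at hy
    rw [apply_eq_of_mem_of_comm_of_isFinitelySemisimple_of_isNil hy hS₀
      hS.isFinitelySemisimple hN]
  have hspan (y : 𝔤) : y ∈ ⨆ μ : ℂ, (LieAlgebra.ad ℂ 𝔤 L).maxGenEigenspace μ := by
    rw [iSup_maxGenEigenspace_eq_top]; trivial
  -- `S` is the scalar `μ` on each generalized eigenspace, and brackets add eigenvalues; hence `S`
  -- is a derivation, and therefore inner.
  have hder (y y' : 𝔤) : S ⁅y, y'⁆ = ⁅S y, y'⁆ + ⁅y, S y'⁆ := by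
    induction hspan y using Submodule.iSup_induction' with
    | mem μ y hy =>
      induction hspan y' using Submodule.iSup_induction' with
      | mem μ' y' hy' =>
        rw [aux μ y hy, aux μ' y' hy', aux (μ + μ') _
          (LieModule.lie_mem_maxGenEigenspace_toEnd hy hy'),
          smul_lie, lie_smul, add_smul]
      | zero => simp
      | add _ _ _ _ h h' => simp only [lie_add, map_add, h, h']; abel
    | zero => simp
    | add _ _ _ _ h h' => simp only [add_lie, map_add, h, h']; abel
  replace hder : ∀ y z : 𝔤, S ⁅y, z⁆ = ⁅y, S z⁆ - ⁅z, S y⁆ := by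
    simp_rw [← lie_skew (S _) _, add_comm, ← sub_eq_add_neg] at hder; assumption
  let S' : LieDerivation ℂ 𝔤 𝔤 := ⟨S, hder⟩
  obtain ⟨s, hs⟩ := LieDerivation.IsKilling.exists_eq_ad S'
  have hs' : S = LieAlgebra.ad ℂ 𝔤 s := by
    rw [← LieDerivation.coe_ad_apply_eq_ad_apply s, hs]
  refine ⟨s, fun μ y hy ↦ ?_, hs' ▸ hN⟩
  rw [← aux μ y hy, hs', LieAlgebra.ad_apply]

omit [FiniteDimensional ℂ 𝔤] [LieAlgebra.IsKilling ℂ 𝔤] in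
theorem rot_mem_maxGenEigenspace {ζ : ℂ} (hζ : ζ ^ G.h = 1) (hζ0 : ζ ≠ 0) {μ : ℂ} {y : 𝔤}
    (hy : y ∈ (LieAlgebra.ad ℂ 𝔤 G.cyc).maxGenEigenspace μ) :
    G.rot ζ y ∈ (LieAlgebra.ad ℂ 𝔤 G.cyc).maxGenEigenspace (ζ⁻¹ * μ) := by
  rw [Module.End.mem_maxGenEigenspace] at hy ⊢
  obtain ⟨k, hk⟩ := hy
  refine ⟨k, ?_⟩
  have h1 (x : 𝔤) : (LieAlgebra.ad ℂ 𝔤 G.cyc - (ζ⁻¹ * μ) • (1 : Module.End ℂ 𝔤)) (G.rot ζ x) =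
      ζ⁻¹ • G.rot ζ ((LieAlgebra.ad ℂ 𝔤 G.cyc - μ • (1 : Module.End ℂ 𝔤)) x) := by
    simp only [LinearMap.sub_apply, LinearMap.smul_apply, Module.End.one_apply,
      LieAlgebra.ad_apply, map_sub, map_smul, G.rot_lie hζ0, G.rot_cyc hζ, smul_lie, smul_sub,
      smul_smul, inv_mul_cancel₀ hζ0, one_smul]
  have h2 (j : ℕ) (x : 𝔤) :
      ((LieAlgebra.ad ℂ 𝔤 G.cyc - (ζ⁻¹ * μ) • (1 : Module.End ℂ 𝔤)) ^ j) (G.rot ζ x) =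
      (ζ⁻¹) ^ j • G.rot ζ (((LieAlgebra.ad ℂ 𝔤 G.cyc - μ • (1 : Module.End ℂ 𝔤)) ^ j) x) := by
    induction j generalizing x with
    | zero => simp
    | succ j ih =>
      rw [pow_succ, Module.End.mul_apply, h1, map_smul, ih, smul_smul, pow_succ, pow_succ,
        Module.End.mul_apply, mul_comm]
  rw [h2, hk, map_zero, smul_zero]

/-- For a primitive `h`-th root of unity `ζ`, the automorphism `ζ^ρ` multiplies `L` by `ζ`, hence
also the semisimple part `s`. So `s` lives in degrees `1` and `1 - h`, which makes it a multiple `c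
L`. As `L` is not nilpotent, `c ≠ 0`, and the generalized kernel of `ad L` is its kernel. -/
theorem lie_cyc_eq_zero_of_lie_lie {x : 𝔤} (hx : ⁅G.cyc, ⁅G.cyc, x⁆⁆ = 0) : ⁅G.cyc, x⁆ = 0 := by
  have hh := G.two_le_h
  obtain ⟨s, hs, hnil⟩ := LieAlgebra.exists_semisimple_part G.cyc
  obtain ⟨k, hk⟩ : ∃ k : ℕ, G.h = k := ⟨G.h.toNat, by omega⟩
  have hk0 : k ≠ 0 := by omega
  set ζ : ℂ := Complex.exp (2 * Real.pi * Complex.I / k) with hζd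
  have hprim : IsPrimitiveRoot ζ k := Complex.isPrimitiveRoot_exp k hk0
  have hζ0 : ζ ≠ 0 := Complex.exp_ne_zero _
  have hζ : ζ ^ G.h = 1 := by rw [hk, zpow_natCast]; exact hprim.pow_eq_one
  have hcom (y : 𝔤) : ⁅s, G.rot ζ y⁆ = ζ⁻¹ • G.rot ζ ⁅s, y⁆ := by
    have hspan : y ∈ ⨆ μ : ℂ, (LieAlgebra.ad ℂ 𝔤 G.cyc).maxGenEigenspace μ := by
      rw [Module.End.iSup_maxGenEigenspace_eq_top]; trivial
    induction hspan using Submodule.iSup_induction' with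
    | mem μ y hy =>
      rw [hs _ _ (G.rot_mem_maxGenEigenspace hζ hζ0 hy), hs _ _ hy, map_smul, smul_smul]
    | zero => simp
    | add _ _ _ _ h h' => simp only [lie_add, map_add, h, h', smul_add]
  -- Both `s` and `ζ⁻¹ • G.rot ζ s` have the same adjoint action, and the centre is trivial.
  have hrot : G.rot ζ s = ζ • s := by
    have h0 : s - ζ⁻¹ • G.rot ζ s = 0 := by
      have : ∀ y : 𝔤, ⁅s - ζ⁻¹ • G.rot ζ s, y⁆ = 0 := by
        intro y
        obtain ⟨y, rfl⟩ := G.rot_surjective hζ0 y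
        rw [sub_lie, smul_lie, hcom, G.rot_lie hζ0, sub_self]
      rw [← LieDerivation.IsKilling.ad_apply_eq_zero_iff (R := ℂ)]
      ext y
      simpa using this y
    rw [sub_eq_zero] at h0
    conv_rhs => rw [h0]
    rw [smul_smul, mul_inv_cancel₀ hζ0, one_smul]
  have hdeg : ∀ f, f ≠ 1 → f ≠ 1 - G.h → G.P f s = 0 := by
    intro f h1 h2
    by_cases hr : f ≤ -G.h ∨ G.h ≤ f
    · exact G.P_of_le f s hr
    have h3 := G.P_rot ζ f s
    rw [hrot, map_smul] at h3
    by_contra hne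
    have h4 : ζ = ζ ^ f := smul_left_injective ℂ hne h3
    have h5 : ζ ^ (f - 1) = 1 := by
      rw [zpow_sub₀ hζ0, ← h4, zpow_one, div_self hζ0]
    rw [hprim.zpow_eq_one_iff_dvd] at h5
    obtain ⟨q, hq⟩ := h5
    rw [← hk] at hq
    push Not at hr
    have hq1 : q < 1 := by
      by_contra! h; nlinarith
    have hq2 : -2 < q := by
      by_contra! h; nlinarith
    obtain rfl | rfl : q = 0 ∨ q = -1 := by omega
    · omega
    · omega
  have hcs : ⁅G.cyc, s⁆ = 0 := by
    have : ⁅s, G.cyc⁆ = (0 : ℂ) • G.cyc := hs 0 _ <| by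
      rw [Module.End.mem_maxGenEigenspace]
      exact ⟨1, by simp⟩
    rw [← lie_skew, this, zero_smul, neg_zero]
  obtain ⟨c, hc⟩ := G.eq_smul_cyc_of_degrees hdeg hcs
  have hc0 : c ≠ 0 := by
    rintro rfl
    rw [zero_smul] at hc
    rw [hc, map_zero, sub_zero] at hnil
    exact G.not_isNilpotent_ad_cyc hnil
  have h0 : ⁅s, x⁆ = (0 : ℂ) • x := hs 0 _ <| by
    rw [Module.End.mem_maxGenEigenspace]
    exact ⟨2, by simpa [pow_two] using hx⟩
  rw [hc, smul_lie, zero_smul] at h0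
  exact (smul_eq_zero.mp h0).resolve_left hc0

theorem exists_eq_lie_cyc_add (x : 𝔤) : ∃ u s, x = ⁅G.cyc, u⁆ + s ∧ ⁅G.cyc, s⁆ = 0 := by
  set N := LieAlgebra.ad ℂ 𝔤 G.cyc
  have hd : Disjoint (LinearMap.ker N) (LinearMap.range N) := by
    rw [Submodule.disjoint_def]
    rintro _ hx ⟨u, rfl⟩
    exact G.lie_cyc_eq_zero_of_lie_lie hx
  have htop : LinearMap.range N ⊔ LinearMap.ker N = ⊤ := by
    refine Submodule.eq_top_of_disjoint _ _ ?_ hd.symm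
    exact (LinearMap.finrank_range_add_finrank_ker N).ge
  obtain ⟨_, ⟨u, rfl⟩, s, hs, hx⟩ := Submodule.mem_sup.mp (htop ▸ Submodule.mem_top : x ∈ _)
  exact ⟨u, s, hx.symm, hs⟩

omit [FiniteDimensional ℂ 𝔤] [LieAlgebra.IsKilling ℂ 𝔤] in
theorem killingForm_eq_zero_of_degree_zero {H x : 𝔤} (hH : ⁅G.ρ, H⁆ = 0) (hx : G.P 0 x = 0) :
    killingForm ℂ 𝔤 H x = 0 := by
  have h (x : 𝔤) : killingForm ℂ 𝔤 H x = killingForm ℂ 𝔤 H (G.P 0 x) := by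
    induction x using G.hom_induction with
    | hom f x hx =>
      by_cases hf : f = 0
      · subst hf; rw [G.P_self _ _ hx]
      · rw [G.P_of_ne _ _ _ hx hf, map_zero]
        have h1 : killingForm ℂ 𝔤 ⁅H, G.ρ⁆ x = killingForm ℂ 𝔤 H ⁅G.ρ, x⁆ :=
          LieModule.traceForm_apply_lie_apply ℂ 𝔤 𝔤 H G.ρ x
        rw [← lie_skew, hH, neg_zero, map_zero, LinearMap.zero_apply, hx, map_smul] at h1
        exact (smul_eq_zero.mp h1.symm).resolve_left (by exact_mod_cast hf)
    | add x y hx hy => simp only [map_add, hx, hy]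
  rw [h, hx, map_zero]

theorem exists_lie_cyc_eq_of_degree_zero {H : 𝔤} (hH : ⁅G.ρ, H⁆ = 0) :
    ∃ u, ⁅G.cyc, u⁆ = H :=
  LieAlgebra.exists_lie_eq_of_killingForm_eq_zero fun _ hy ↦
    G.killingForm_eq_zero_of_degree_zero hH (G.P_zero_of_lie_cyc hy)

/-- For `y` in the centralizer, `κ([H, s], y) = κ(H, [s, y])`; by Jacobi `[s, y]` again centralizes
`L`, so it has no degree-zero part to pair with `H`. -/
theorem exists_lie_cyc_eq_lie {H s : 𝔤} (hH : ⁅G.ρ, H⁆ = 0) (hs : ⁅G.cyc, s⁆ = 0) :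
    ∃ u, ⁅G.cyc, u⁆ = ⁅H, s⁆ :=
  LieAlgebra.exists_lie_eq_of_killingForm_eq_zero fun y hy ↦ by
    have h : killingForm ℂ 𝔤 ⁅H, s⁆ y = killingForm ℂ 𝔤 H ⁅s, y⁆ :=
      LieModule.traceForm_apply_lie_apply ℂ 𝔤 𝔤 H s y
    rw [h]
    refine G.killingForm_eq_zero_of_degree_zero hH (G.P_zero_of_lie_cyc ?_)
    rw [leibniz_lie, hs, hy, zero_lie, lie_zero, add_zero]

end Killing

end CyclicGrading

end CyclicGrading

/-! ### The principal grading of a simple Lie algebra. -/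

section Construction

variable {𝔤 : Type*} [LieRing 𝔤] [LieAlgebra ℂ 𝔤] [FiniteDimensional ℂ 𝔤] [LieAlgebra.IsSimple ℂ 𝔤]
  {𝔥 : LieSubalgebra ℂ 𝔤} [𝔥.IsCartanSubalgebra] (b : (rootSystem 𝔥).Base)

/-- The component of height `f`, as an eigenspace of `ad ρ^∨`. -/
def heightSpace (f : ℤ) : Submodule ℂ 𝔤 :=
  (LieAlgebra.ad ℂ 𝔤 (rhoCheck b : 𝔤)).eigenspace (f : ℂ)

theorem mem_heightSpace {f : ℤ} {x : 𝔤} :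
    x ∈ heightSpace b f ↔ ⁅(rhoCheck b : 𝔤), x⁆ = (f : ℂ) • x := by
  rw [heightSpace, Module.End.mem_eigenspace_iff, LieAlgebra.ad_apply]

theorem lie_eq_smul_of_mem_rootSpace' {β : 𝔥 → ℂ} {x : 𝔤} (hx : x ∈ rootSpace 𝔥 β) (H : 𝔥) :
    ⁅(H : 𝔤), x⁆ = β H • x :=
  lie_eq_smul_of_mem_rootSpace hx H

theorem rootSpace_le_heightSpace (β : 𝔥.root) :
    (rootSpace 𝔥 (β.1 : 𝔥 → ℂ)).toSubmodule ≤ heightSpace b (b.height β) := by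
  intro x hx
  rw [mem_heightSpace, lie_eq_smul_of_mem_rootSpace' hx]
  congr 1
  exact root_apply_rhoCheck b β

theorem cartan_le_heightSpace : 𝔥.toSubmodule ≤ heightSpace b 0 := by
  intro x hx
  rw [mem_heightSpace, Int.cast_zero, zero_smul]
  have : ⁅rhoCheck b, (⟨x, hx⟩ : 𝔥)⁆ = 0 := trivial_lie_zero _ _ _ _
  simpa using congrArg (Subtype.val) this

omit [LieAlgebra.IsSimple ℂ 𝔤] in
theorem cartan_sup_rootSpaces_eq_top {S : Submodule ℂ 𝔤} (h0 : 𝔥.toSubmodule ≤ S)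
    (hS : ∀ β : 𝔥.root, (rootSpace 𝔥 (β.1 : 𝔥 → ℂ)).toSubmodule ≤ S) : S = ⊤ := by
  have h := LieModule.iSup_genWeightSpace_eq_top' ℂ 𝔥 𝔤
  rw [← LieSubmodule.toSubmodule_inj, LieSubmodule.iSup_toSubmodule,
    LieSubmodule.top_toSubmodule] at h
  rw [eq_top_iff, ← h]
  refine iSup_le fun χ ↦ ?_
  by_cases hχ : χ.IsZero
  · have : (χ : 𝔥 → ℂ) = 0 := hχ
    rw [this]
    intro x hx
    refine h0 ?_
    have h2 : x ∈ rootSpace 𝔥 (0 : 𝔥 → ℂ) := hx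
    rw [rootSpace_zero_eq] at h2
    exact h2
  · exact hS ⟨χ, by simpa using hχ⟩

theorem heightSpace_iSupIndep : iSupIndep (heightSpace b) :=
  (Module.End.eigenspaces_iSupIndep (LieAlgebra.ad ℂ 𝔤 (rhoCheck b : 𝔤))).comp
    (f := fun f : ℤ ↦ (f : ℂ)) Int.cast_injective

/-- Eigenspaces are independent, so a subspace that spans everything together with the other
eigenspaces fills its own. It identifies height spaces from the root decomposition. -/
theorem le_heightSpace_of_iSup_eq_top {f : ℤ} {W : Submodule ℂ 𝔤} (hW : W ≤ heightSpace b f)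
    (h : W ⊔ ⨆ (a : ℤ) (_ : a ≠ f), heightSpace b a = ⊤) : heightSpace b f = W := by
  refine le_antisymm (fun x hx ↦ ?_) hW
  obtain ⟨w, hw, y, hy, rfl⟩ := Submodule.mem_sup.mp (h ▸ Submodule.mem_top : x ∈ _)
  have : y = 0 := by
    refine Submodule.disjoint_def.mp (heightSpace_iSupIndep b f) y ?_ hy
    simpa using sub_mem hx (hW hw)
  simpa [this] using hw

theorem heightSpace_zero : heightSpace b 0 = 𝔥.toSubmodule := by
  refine le_heightSpace_of_iSup_eq_top b (cartan_le_heightSpace b) ?_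
  refine cartan_sup_rootSpaces_eq_top le_sup_left fun β ↦ le_sup_of_le_right ?_
  exact le_iSup₂_of_le _ (b.height_ne_zero β) (rootSpace_le_heightSpace b β)

theorem heightSpace_eq_iSup {f : ℤ} (hf : f ≠ 0) : heightSpace b f =
    ⨆ β : {β : 𝔥.root // b.height β = f}, (rootSpace 𝔥 (β.1.1 : 𝔥 → ℂ)).toSubmodule := by
  refine le_heightSpace_of_iSup_eq_top b (iSup_le fun β ↦ ?_) ?_
  · simpa only [β.2] using rootSpace_le_heightSpace b β.1
  · refine cartan_sup_rootSpaces_eq_top (𝔥 := 𝔥) ?_ fun β ↦ ?_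
    · exact le_sup_of_le_right (le_iSup₂_of_le 0 hf.symm (cartan_le_heightSpace b))
    · by_cases h : b.height β = f
      · exact le_sup_of_le_left (le_iSup (fun β : {β : 𝔥.root // b.height β = f} ↦
          (rootSpace 𝔥 (β.1.1 : 𝔥 → ℂ)).toSubmodule) ⟨β, h⟩)
      · exact le_sup_of_le_right (le_iSup₂_of_le _ h (rootSpace_le_heightSpace b β))

theorem iSup_heightSpace : ⨆ f : ℤ, heightSpace b f = ⊤ :=
  cartan_sup_rootSpaces_eq_top (𝔥 := 𝔥) (le_iSup_of_le 0 (cartan_le_heightSpace b)) fun β ↦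
    le_iSup_of_le _ (rootSpace_le_heightSpace b β)

theorem heightSpace_eq_bot {θ : 𝔥.root} (hθ : IsHighestRoot b θ) {f : ℤ}
    (hf : f ≤ -coxeterNumber b θ ∨ coxeterNumber b θ ≤ f) : heightSpace b f = ⊥ := by
  have h2 := two_le_coxeterNumber b hθ
  rw [heightSpace_eq_iSup b (by omega), iSup_eq_bot]
  rintro ⟨β, hβ⟩
  have := abs_height_lt b hθ β
  omega

theorem bijective_coeLinearMap_heightSpace :
    Function.Bijective (DirectSum.coeLinearMap (heightSpace b)) :=
  DirectSum.isInternal_submodule_of_iSupIndep_of_iSup_eq_top (heightSpace_iSupIndep b)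
    (iSup_heightSpace b)

/-- The projection onto the component of height `f`. -/
def heightProj (f : ℤ) : 𝔤 →ₗ[ℂ] 𝔤 :=
  (heightSpace b f).subtype ∘ₗ DirectSum.component ℂ ℤ (fun f ↦ heightSpace b f) f ∘ₗ
    (LinearEquiv.ofBijective (DirectSum.coeLinearMap (heightSpace b))
      (bijective_coeLinearMap_heightSpace b)).symm.toLinearMap

theorem heightProj_mem (f : ℤ) (x : 𝔤) : heightProj b f x ∈ heightSpace b f := by
  simp [heightProj]

theorem heightProj_apply (f a : ℤ) (x : 𝔤) (hx : x ∈ heightSpace b a) :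
    heightProj b f x = if a = f then x else 0 := by
  have h : (LinearEquiv.ofBijective (DirectSum.coeLinearMap (heightSpace b))
      (bijective_coeLinearMap_heightSpace b)).symm x =
      DirectSum.lof ℂ ℤ (fun f ↦ heightSpace b f) a ⟨x, hx⟩ := by
    rw [LinearEquiv.symm_apply_eq, LinearEquiv.ofBijective_apply, DirectSum.coeLinearMap_lof]
  simp only [heightProj, LinearMap.comp_apply, LinearEquiv.coe_coe, h]
  split_ifs with haf
  · subst haf
    rw [DirectSum.component.lof_self]; rfl
  · rw [DirectSum.component.of, dif_neg haf]; rfl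

theorem sum_heightProj {θ : 𝔥.root} (hθ : IsHighestRoot b θ) (x : 𝔤) :
    ∑ f ∈ Finset.Ioo (-coxeterNumber b θ) (coxeterNumber b θ), heightProj b f x = x := by
  have hx : x ∈ ⨆ f, heightSpace b f := by rw [iSup_heightSpace]; trivial
  induction hx using Submodule.iSup_induction' with
  | mem a x hx =>
    by_cases ha : a ∈ Finset.Ioo (-coxeterNumber b θ) (coxeterNumber b θ)
    · simp_rw [heightProj_apply b _ a x hx]
      rw [Finset.sum_ite_eq, if_pos ha]
    · rw [heightSpace_eq_bot b hθ, Submodule.mem_bot] at hx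
      · simp [hx]
      · rw [Finset.mem_Ioo] at ha
        omega
  | zero => simp
  | add _ _ _ _ h h' => simp only [map_add, Finset.sum_add_distrib, h, h']

theorem eq_zero_of_root_apply_eq_zero {H : 𝔥}
    (h : ∀ i ∈ b.support, (rootSystem 𝔥).root i H = 0) : H = 0 := by
  have hs := b.span_root_support
  have h2 : ∀ φ : Module.Dual ℂ 𝔥, φ H = 0 := by
    intro φ
    have hφ : φ ∈ Submodule.span ℂ ((rootSystem 𝔥).root '' b.support) := by
      have ht : (rootSystem 𝔥).rootSpan ℂ = ⊤ := RootPairing.IsRootSystem.span_root_eq_top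
      rw [hs, ht]; trivial
    induction hφ using Submodule.span_induction with
    | mem φ hφ => obtain ⟨i, hi, rfl⟩ := hφ; exact h i hi
    | zero => simp
    | add x y _ _ hx hy => simp [hx, hy]
    | smul c x _ hx => simp [hx]
  exact (Module.forall_dual_apply_eq_zero_iff ℂ H).mp h2

variable {b} (c : ChevalleyGenerators b)

theorem coroot_ne_zero (i : 𝔥.root) : ((rootSystem 𝔥).coroot i : 𝔤) ≠ 0 := by
  intro h
  exact (rootSystem 𝔥).flip.ne_zero i (Subtype.ext h)

namespace ChevalleyGenerators

theorem lie_cartan_e (H : 𝔥) (i : b.support) :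
    ⁅(H : 𝔤), c.e i⁆ = (rootSystem 𝔥).root i H • c.e i :=
  lie_eq_smul_of_mem_rootSpace' (c.e_mem i) H

open Classical in
theorem lie_f_e (i j : b.support) :
    ⁅c.f j, c.e i⁆ = if i = j then -((rootSystem 𝔥).coroot j : 𝔤) else 0 := by
  split_ifs with h
  · rw [← c.lie_e_f j, h, lie_skew]
  · have h1 := LieAlgebra.lie_mem_genWeightSpace_of_mem_genWeightSpace (c.f_mem j) (c.e_mem i)
    by_contra hne
    have hnot := b.sub_notMem_range_root i.2 j.2
    have hw : LieModule.genWeightSpace 𝔤 (-(j.1.1 : 𝔥 → ℂ) + (i.1.1 : 𝔥 → ℂ)) ≠ ⊥ := by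
      intro hb
      have h2 : ⁅c.f j, c.e i⁆ ∈
          LieModule.genWeightSpace 𝔤 (-(j.1.1 : 𝔥 → ℂ) + (i.1.1 : 𝔥 → ℂ)) := h1
      rw [hb] at h2
      exact hne (by simpa using h2)
    let χ : LieModule.Weight ℂ 𝔥 𝔤 := ⟨_, hw⟩
    have hχ : χ.IsNonZero := by
      intro h0
      have h0' : -(j.1.1 : 𝔥 → ℂ) + (i.1.1 : 𝔥 → ℂ) = 0 := h0
      refine h (Subtype.ext ((rootSystem 𝔥).root.injective ?_))
      ext H
      have := congrFun h0' H
      simp only [Pi.add_apply, Pi.neg_apply, Pi.zero_apply] at this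
      exact (neg_add_eq_zero.mp this).symm
    refine hnot ⟨⟨χ, by simpa using hχ⟩, ?_⟩
    ext H
    change -(j.1.1 : 𝔥 → ℂ) H + (i.1.1 : 𝔥 → ℂ) H = (i.1.1 : 𝔥 → ℂ) H - (j.1.1 : 𝔥 → ℂ) H
    ring

/-- Bracketing with `f_j` isolates the `j`-th coefficient, because differences of simple roots are
not roots. -/
theorem lie_f_sum (a : b.support → ℂ) (j : b.support) :
    ⁅c.f j, ∑ i, a i • c.e i⁆ = -(a j • ((rootSystem 𝔥).coroot j : 𝔤)) := by
  rw [lie_sum, Finset.sum_eq_single j]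
  · rw [lie_smul, lie_f_e, if_pos rfl, smul_neg]
  · intro i _ hij
    rw [lie_smul, lie_f_e, if_neg hij, smul_zero]
  · simp

theorem eq_zero_of_sum_eq_zero {a : b.support → ℂ} (h : ∑ i, a i • c.e i = 0) (j : b.support) :
    a j = 0 := by
  have := c.lie_f_sum a j
  rw [h, lie_zero, eq_comm, neg_eq_zero] at this
  exact (smul_eq_zero.mp this).resolve_right (coroot_ne_zero _)

theorem lie_cartan_sum (H : 𝔥) (a : b.support → ℂ) :
    ⁅(H : 𝔤), ∑ i, a i • c.e i⁆ = ∑ i, (a i * (rootSystem 𝔥).root i H) • c.e i := by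
  rw [lie_sum]
  refine Finset.sum_congr rfl fun i _ ↦ ?_
  rw [lie_smul, c.lie_cartan_e, smul_smul]

theorem mem_rootSpace_exists_smul {χ : 𝔥.root} {x y : 𝔤} (hx : x ∈ rootSpace 𝔥 (χ.1 : 𝔥 → ℂ))
    (hx0 : x ≠ 0) (hy : y ∈ rootSpace 𝔥 (χ.1 : 𝔥 → ℂ)) : ∃ a : ℂ, y = a • x := by
  have h1 := finrank_rootSpace_eq_one χ.1 (LieSubalgebra.isNonZero_coe_root χ)
  obtain ⟨a, ha⟩ := (finrank_eq_one_iff_of_nonzero' (⟨x, hx⟩ : rootSpace 𝔥 (χ.1 : 𝔥 → ℂ))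
    (by simpa using hx0)).mp h1 ⟨y, hy⟩
  exact ⟨a, (congrArg Subtype.val ha).symm⟩

theorem exists_eq_sum_of_mem_heightSpace_one {y : 𝔤} (hy : y ∈ heightSpace b 1) :
    ∃ a : b.support → ℂ, y = ∑ i, a i • c.e i := by
  have hle : heightSpace b 1 ≤ Submodule.span ℂ (Set.range c.e) := by
    rw [heightSpace_eq_iSup b one_ne_zero]
    refine iSup_le fun β x hx ↦ ?_
    have hβ := mem_support_of_height_eq_one b β.2
    have he : c.e ⟨β.1, hβ⟩ ≠ 0 := by
      intro h0
      have := c.lie_e_f ⟨β.1, hβ⟩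
      rw [h0, zero_lie] at this
      exact coroot_ne_zero _ this.symm
    obtain ⟨a, rfl⟩ := mem_rootSpace_exists_smul (c.e_mem ⟨β.1, hβ⟩) he hx
    exact Submodule.smul_mem _ _ (Submodule.subset_span ⟨_, rfl⟩)
  obtain ⟨a, ha⟩ := (Submodule.mem_span_range_iff_exists_fun ℂ).mp (hle hy)
  exact ⟨a, ha.symm⟩

theorem lie_rhoCheck_sum_e : ⁅(rhoCheck b : 𝔤), ∑ i, c.e i⁆ = ∑ i, c.e i := by
  have := c.lie_cartan_sum (rhoCheck b) 1
  simp only [Pi.one_apply, one_smul, one_mul] at this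
  rw [this]
  refine Finset.sum_congr rfl fun i _ ↦ ?_
  rw [root_apply_rhoCheck_of_mem_support b i.2, one_smul]

theorem eq_zero_of_lie_sum_e_eq_zero {H : 𝔤} (hH : H ∈ heightSpace b 0)
    (h : ⁅∑ i, c.e i, H⁆ = 0) : H = 0 := by
  rw [heightSpace_zero] at hH
  lift H to 𝔥 using hH
  have := c.lie_cartan_sum H 1
  simp only [Pi.one_apply, one_smul, one_mul] at this
  rw [← lie_skew, h, neg_zero] at this
  have h0 : H = 0 := eq_zero_of_root_apply_eq_zero b fun i hi ↦
    c.eq_zero_of_sum_eq_zero this.symm ⟨i, hi⟩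
  rw [h0]; rfl

variable {θ : 𝔥.root} {E₀ : 𝔤}

theorem lie_rhoCheck_lowest (hE₀ : E₀ ∈ rootSpace 𝔥 (-(θ.1 : 𝔥 → ℂ))) :
    ⁅(rhoCheck b : 𝔤), E₀⁆ = ((1 - coxeterNumber b θ : ℤ) : ℂ) • E₀ := by
  rw [lie_eq_smul_of_mem_rootSpace' hE₀]
  congr 1
  have := root_apply_rhoCheck b θ
  rw [coxeterNumber, show 1 - (b.height θ + 1) = -b.height θ by ring, Int.cast_neg, ← this]
  rfl

theorem exists_smul_lowest (hθ : IsHighestRoot b θ) (hE₀ : E₀ ∈ rootSpace 𝔥 (-(θ.1 : 𝔥 → ℂ)))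
    (hE₀_ne : E₀ ≠ 0) {y : 𝔤} (hy : y ∈ heightSpace b (1 - coxeterNumber b θ)) :
    ∃ a : ℂ, y = a • E₀ := by
  have h2 := two_le_coxeterNumber b hθ
  have hle : heightSpace b (1 - coxeterNumber b θ) ≤ Submodule.span ℂ {E₀} := by
    rw [heightSpace_eq_iSup b (by omega)]
    refine iSup_le fun β x hx ↦ ?_
    obtain ⟨β', hβ1, hβ2⟩ := height_neg b β.1
    have hβ : β' = θ := by
      refine (height_le_of_isHighestRoot b hθ β').2 ?_
      rw [hβ1, β.2, coxeterNumber]; ring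
    have hβ3 : (β.1.1 : 𝔥 → ℂ) = -(θ.1 : 𝔥 → ℂ) := by
      ext H
      have := congrArg (fun φ : Module.Dual ℂ 𝔥 ↦ φ H) hβ2
      rw [hβ] at this
      have h3 : (θ.1 : 𝔥 → ℂ) H = -(β.1.1 : 𝔥 → ℂ) H := this
      rw [Pi.neg_apply, h3, neg_neg]
    rw [← hβ3] at hE₀
    obtain ⟨a, rfl⟩ := mem_rootSpace_exists_smul hE₀ hE₀_ne hx
    exact Submodule.smul_mem _ _ (Submodule.subset_span rfl)
  obtain ⟨a, ha⟩ := Submodule.mem_span_singleton.mp (hle hy)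
  exact ⟨a, ha.symm⟩

/-- Each `f_j` kills the lowest root vector. If `∑ eᵢ` commuted with it too, so would every simple
coroot, and `θ` would vanish on `𝔥`. -/
theorem lie_sum_e_lowest_ne_zero (hθ : IsHighestRoot b θ)
    (hE₀ : E₀ ∈ rootSpace 𝔥 (-(θ.1 : 𝔥 → ℂ))) (hE₀_ne : E₀ ≠ 0) : ⁅E₀, ∑ i, c.e i⁆ ≠ 0 := by
  intro h
  have hf (j : b.support) : ⁅c.f j, E₀⁆ = 0 := by
    have h1 : ⁅(rhoCheck b : 𝔤), c.f j⁆ = ((-1 : ℤ) : ℂ) • c.f j := by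
      rw [lie_eq_smul_of_mem_rootSpace' (c.f_mem j)]
      congr 1
      have := root_apply_rhoCheck_of_mem_support b j.2
      push_cast
      rw [← this]; rfl
    have h2 : ⁅c.f j, E₀⁆ ∈ heightSpace b (-coxeterNumber b θ) := by
      rw [mem_heightSpace, leibniz_lie, h1, lie_rhoCheck_lowest hE₀, smul_lie, lie_smul, ← add_smul]
      congr 1
      push_cast; ring
    rw [heightSpace_eq_bot b hθ (by left; rfl)] at h2
    simpa using h2
  have hθj (j : b.support) : (rootSystem 𝔥).root θ ((rootSystem 𝔥).coroot j) = 0 := by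
    have h1 := congrArg (fun x ↦ ⁅c.f j, x⁆) h
    have h3 := c.lie_f_sum 1 j
    simp only [Pi.one_apply, one_smul] at h3
    simp only [lie_zero] at h1
    rw [leibniz_lie, hf, zero_lie, zero_add, h3, lie_neg, lie_skew,
      lie_eq_smul_of_mem_rootSpace' hE₀] at h1
    have h4 := (smul_eq_zero.mp h1).resolve_right hE₀_ne
    exact neg_eq_zero.mp h4
  have hs := b.span_coroot_support
  have ht : (rootSystem 𝔥).corootSpan ℂ = ⊤ := RootPairing.IsRootSystem.span_coroot_eq_top
  rw [ht] at hs
  refine (rootSystem 𝔥).ne_zero θ (LinearMap.ext_on hs ?_)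
  rintro _ ⟨j, hj, rfl⟩
  exact hθj ⟨j, hj⟩

/-- Write `y = ∑ aᵢ eᵢ`. Bracketing `[∑ eᵢ, y] = 0` with `f_j` gives `aᵢ = a_j` along every edge of
the Dynkin diagram, which is connected. So `y` is a multiple of `∑ eᵢ`, which does not commute with
`E₀`. -/
theorem eq_zero_of_lie_eq_zero (hθ : IsHighestRoot b θ)
    (hE₀ : E₀ ∈ rootSpace 𝔥 (-(θ.1 : 𝔥 → ℂ))) (hE₀_ne : E₀ ≠ 0) {y : 𝔤}
    (hy : y ∈ heightSpace b 1) (hey : ⁅∑ i, c.e i, y⁆ = 0) (hEy : ⁅E₀, y⁆ = 0) : y = 0 := by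
  obtain ⟨a, rfl⟩ := c.exists_eq_sum_of_mem_heightSpace_one hy
  have hrel (i j : b.support) :
      (a j - a i) * (rootSystem 𝔥).root i ((rootSystem 𝔥).coroot j) = 0 := by
    have h3 := c.lie_f_sum 1 j
    simp only [Pi.one_apply, one_smul] at h3
    have h1 := congrArg (fun x ↦ ⁅c.f j, x⁆) hey
    simp only [lie_zero] at h1
    have h4 := c.lie_cartan_sum ((rootSystem 𝔥).coroot j) 1
    simp only [Pi.one_apply, one_smul, one_mul] at h4
    rw [leibniz_lie, c.lie_f_sum, h3, neg_lie, c.lie_cartan_sum, lie_neg, lie_smul, ← lie_skew, h4,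
      smul_neg, neg_neg, Finset.smul_sum, neg_add_eq_sub, ← Finset.sum_sub_distrib] at h1
    refine c.eq_zero_of_sum_eq_zero (a := fun i ↦
      (a j - a i) * (rootSystem 𝔥).root i ((rootSystem 𝔥).coroot j)) ?_ i
    rw [← h1]
    refine Finset.sum_congr rfl fun i _ ↦ ?_
    rw [smul_smul, ← sub_smul, sub_mul]
  obtain ⟨i₀, hi₀⟩ : b.support.Nonempty := by
    have : Nonempty 𝔥.root := ⟨θ⟩
    exact b.support_nonempty
  have hconst (j : b.support) : a j = a ⟨i₀, hi₀⟩ := by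
    refine b.induction_on_cartanMatrix (fun j ↦ a j = a ⟨i₀, hi₀⟩) (i := ⟨i₀, hi₀⟩) rfl ?_
    intro i j hi hji
    rw [ne_eq, RootPairing.Base.cartanMatrix_apply_eq_zero_iff_pairing] at hji
    have h1 := (mul_eq_zero.mp (hrel j i)).resolve_right hji
    rw [← hi]
    exact (sub_eq_zero.mp h1).symm
  have hsum : ∑ i, a i • c.e i = a ⟨i₀, hi₀⟩ • ∑ i, c.e i := by
    rw [Finset.smul_sum]
    exact Finset.sum_congr rfl fun i _ ↦ by rw [hconst i]
  rw [hsum, lie_smul, smul_eq_zero] at hEy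
  rw [hsum, hEy.resolve_right (c.lie_sum_e_lowest_ne_zero hθ hE₀ hE₀_ne), zero_smul]

/-- The principal grading of `𝔤` with its cyclic element. -/
def cyclicGrading (hθ : IsHighestRoot b θ) (hE₀ : E₀ ∈ rootSpace 𝔥 (-(θ.1 : 𝔥 → ℂ)))
    (hE₀_ne : E₀ ≠ 0) : CyclicGrading 𝔤 where
  h := coxeterNumber b θ
  two_le_h := two_le_coxeterNumber b hθ
  ρ := rhoCheck b
  P := heightProj b
  lie_P f x := (mem_heightSpace b).mp (heightProj_mem b f x)
  P_self f x hx := by rw [heightProj_apply b f f x ((mem_heightSpace b).mpr hx), if_pos rfl]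
  P_of_ne f a x hx h := by rw [heightProj_apply b f a x ((mem_heightSpace b).mpr hx), if_neg h]
  P_of_le f x hf := by
    have := heightProj_mem b f x
    rw [heightSpace_eq_bot b hθ hf] at this
    simpa using this
  sum_P := sum_heightProj b hθ
  e := ∑ i, c.e i
  lie_e := c.lie_rhoCheck_sum_e
  E := E₀
  lie_E := lie_rhoCheck_lowest hE₀
  E_ne_zero := hE₀_ne
  exists_smul_E _ hy := exists_smul_lowest hθ hE₀ hE₀_ne ((mem_heightSpace b).mpr hy)
  eq_zero_of_degree_zero H h1 h2 :=
    c.eq_zero_of_lie_sum_e_eq_zero ((mem_heightSpace b).mpr (by simpa using h1)) h2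
  eq_zero_of_degree_one y h1 h2 h3 :=
    c.eq_zero_of_lie_eq_zero hθ hE₀ hE₀_ne ((mem_heightSpace b).mpr (by simpa using h1)) h2 h3

end ChevalleyGenerators

end Construction

/-! ### Coefficients and the `1/z`-adic filtration of matrices. -/

section MatrixCoefficients

variable {n : ℕ}

/-- An explicit interval of summation reduces the filtration estimates to checking that the interval
is empty. -/
theorem coeff_mul_eq_sum_Icc {x y : K} {a c : ℤ} (hx : ∀ k < a, x.coeff k = 0)
    (hy : ∀ k < c, y.coeff k = 0) (m : ℤ) :
    (x * y).coeff m = ∑ p ∈ Finset.Icc a (m - c), x.coeff p * y.coeff (m - p) := by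
  rw [HahnSeries.coeff_mul]
  have hinj : Function.Injective (fun p : ℤ ↦ (p, m - p)) := fun p q h ↦ (Prod.mk.inj h).1
  refine Eq.trans ?_
    (Finset.sum_map (Finset.Icc a (m - c)) ⟨_, hinj⟩ (fun ij ↦ x.coeff ij.1 * y.coeff ij.2))
  refine Finset.sum_subset (fun ij hij ↦ ?_) fun ij hij hij' ↦ ?_
  · rw [Finset.mem_antidiagonal] at hij
    obtain ⟨h1, h2, h3⟩ := hij
    rw [HahnSeries.mem_support] at h1 h2
    have h4 : a ≤ ij.1 := by by_contra! h; exact h1 (hx _ h)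
    have h5 : c ≤ ij.2 := by by_contra! h; exact h2 (hy _ h)
    rw [Finset.mem_map]
    refine ⟨ij.1, Finset.mem_Icc.mpr ⟨h4, by omega⟩, ?_⟩
    exact Prod.ext rfl (by simp; omega)
  · rw [Finset.mem_map] at hij
    obtain ⟨p, hp, rfl⟩ := hij
    rw [Finset.mem_antidiagonal] at hij'
    by_contra hne
    refine hij' ⟨?_, ?_, by simp⟩
    · exact left_ne_zero_of_mul hne
    · exact right_ne_zero_of_mul hne

/-- The coefficient matrix of `z ^ (-m)`. -/
def cf (m : ℤ) : Matrix (Fin n) (Fin n) K →ₗ[ℂ] Matrix (Fin n) (Fin n) ℂ where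
  toFun M := Matrix.of fun i j ↦ (M i j).coeff m
  map_add' M N := by ext; simp
  map_smul' c M := by ext; simp

theorem cf_apply (m : ℤ) (M : Matrix (Fin n) (Fin n) K) (i j : Fin n) :
    cf m M i j = (M i j).coeff m := rfl

theorem ext_cf {M N : Matrix (Fin n) (Fin n) K} (h : ∀ m, cf m M = cf m N) : M = N := by
  ext i j m
  exact congrFun (congrFun (h m) i) j

/-- The matrices divisible by `z ^ (-N)`. -/
def fil (n : ℕ) (N : ℤ) : Submodule ℂ (Matrix (Fin n) (Fin n) K) where
  carrier := {M | ∀ m < N, cf m M = 0}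
  add_mem' h h' m hm := by rw [map_add, h m hm, h' m hm, add_zero]
  zero_mem' m _ := map_zero _
  smul_mem' c M h m hm := by rw [map_smul, h m hm, smul_zero]

theorem fil_anti {N N' : ℤ} (h : N ≤ N') : fil n N' ≤ fil n N :=
  fun _ hM m hm ↦ hM m (hm.trans_le h)

theorem exists_coeff_eq_zero (x : K) : ∃ N : ℤ, ∀ k < N, x.coeff k = 0 :=
  ⟨x.order, fun _ ↦ HahnSeries.coeff_eq_zero_of_lt_order⟩

theorem exists_mem_fil (M : Matrix (Fin n) (Fin n) K) : ∃ N, M ∈ fil n N := by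
  choose N hN using fun i j ↦ exists_coeff_eq_zero (M i j)
  obtain ⟨N₀, hN₀⟩ : BddBelow (Set.range fun p : Fin n × Fin n ↦ N p.1 p.2) :=
    (Set.finite_range _).bddBelow
  refine ⟨N₀, fun m hm ↦ ?_⟩
  ext i j
  exact hN i j m (hm.trans_le (hN₀ ⟨(i, j), rfl⟩))

theorem eq_zero_of_forall_mem_fil {M : Matrix (Fin n) (Fin n) K} (h : ∀ N : ℕ, M ∈ fil n N) :
    M = 0 :=
  ext_cf fun m ↦ by rw [map_zero]; exact h (m.toNat + 1) m (by push_cast; omega)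

theorem exists_cf_eq (c : ℤ → Matrix (Fin n) (Fin n) ℂ) {N : ℤ} (hc : ∀ m < N, c m = 0) :
    ∃ M : Matrix (Fin n) (Fin n) K, ∀ m, cf m M = c m := by
  have hb (i j : Fin n) : BddBelow (Function.support fun m ↦ c m i j) := by
    refine ⟨N, fun m hm ↦ ?_⟩
    by_contra! h
    exact hm (by simp [hc m h])
  exact ⟨Matrix.of fun i j ↦ HahnSeries.ofSuppBddBelow (fun m ↦ c m i j) (hb i j),
    fun m ↦ by ext i j; rfl⟩

theorem cf_mul {M N : Matrix (Fin n) (Fin n) K} {a c : ℤ} (hM : M ∈ fil n a) (hN : N ∈ fil n c)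
    (m : ℤ) : cf m (M * N) = ∑ p ∈ Finset.Icc a (m - c), cf p M * cf (m - p) N := by
  ext i j
  rw [cf_apply, Matrix.mul_apply, HahnSeries.coeff_sum, Matrix.sum_apply]
  simp_rw [Matrix.mul_apply]
  rw [Finset.sum_comm]
  refine Finset.sum_congr rfl fun k _ ↦ ?_
  exact coeff_mul_eq_sum_Icc (fun p hp ↦ congrFun (congrFun (hM p hp) i) k)
    (fun p hp ↦ congrFun (congrFun (hN p hp) k) j) m

theorem mul_mem_fil {M N : Matrix (Fin n) (Fin n) K} {a c : ℤ} (hM : M ∈ fil n a)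
    (hN : N ∈ fil n c) : M * N ∈ fil n (a + c) := fun m hm ↦ by
  rw [cf_mul hM hN, Finset.Icc_eq_empty (by omega), Finset.sum_empty]

theorem cf_lie {M N : Matrix (Fin n) (Fin n) K} {a c : ℤ} (hM : M ∈ fil n a) (hN : N ∈ fil n c)
    (m : ℤ) : cf m ⁅M, N⁆ = ∑ p ∈ Finset.Icc a (m - c), ⁅cf p M, cf (m - p) N⁆ := by
  rw [Ring.lie_def, map_sub, cf_mul hM hN, cf_mul hN hM]
  simp_rw [Ring.lie_def]
  rw [Finset.sum_sub_distrib]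
  congr 1
  refine Finset.sum_nbij' (fun p ↦ m - p) (fun p ↦ m - p) ?_ ?_ ?_ ?_ ?_
  · intro p hp; rw [Finset.mem_Icc] at hp ⊢; omega
  · intro p hp; rw [Finset.mem_Icc] at hp ⊢; omega
  · intro p _; ring
  · intro p _; ring
  · intro p _; rw [sub_sub_cancel]

theorem lie_mem_fil {M N : Matrix (Fin n) (Fin n) K} {a c : ℤ} (hM : M ∈ fil n a)
    (hN : N ∈ fil n c) : ⁅M, N⁆ ∈ fil n (a + c) := fun m hm ↦ by
  rw [cf_lie hM hN, Finset.Icc_eq_empty (by omega), Finset.sum_empty]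

/-- The entrywise derivation `∂_z` of matrices. -/
def mdz : Matrix (Fin n) (Fin n) K →ₗ[ℂ] Matrix (Fin n) (Fin n) K := dz.mapMatrix

theorem mdz_apply (M : Matrix (Fin n) (Fin n) K) (i j : Fin n) : mdz M i j = dz (M i j) := rfl

theorem dz_coeff (f : K) (k : ℤ) : (dz f).coeff k = ((1 - k : ℤ) : ℂ) * f.coeff (k - 1) := by
  have := dzFun_coeff f (-k)
  rw [neg_neg, show -(-k + 1) = k - 1 by ring, show -k + 1 = 1 - k by ring] at this
  exact this

theorem dz_mul (x y : K) : dz (x * y) = dz x * y + x * dz y := by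
  obtain ⟨a, ha⟩ := exists_coeff_eq_zero x
  obtain ⟨c, hc⟩ := exists_coeff_eq_zero y
  have ha' : ∀ k < a + 1, (dz x).coeff k = 0 := fun k hk ↦ by
    rw [dz_coeff, ha _ (by omega), mul_zero]
  have hc' : ∀ k < c + 1, (dz y).coeff k = 0 := fun k hk ↦ by
    rw [dz_coeff, hc _ (by omega), mul_zero]
  ext k
  rw [HahnSeries.coeff_add, dz_coeff, coeff_mul_eq_sum_Icc ha hc, coeff_mul_eq_sum_Icc ha' hc,
    coeff_mul_eq_sum_Icc ha hc', show k - (c + 1) = k - 1 - c by ring]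
  have h1 : ∑ p ∈ Finset.Icc (a + 1) (k - c), (dz x).coeff p * y.coeff (k - p) =
      ∑ p ∈ Finset.Icc a (k - 1 - c), (dz x).coeff (p + 1) * y.coeff (k - (p + 1)) := by
    refine Finset.sum_nbij' (fun p ↦ p - 1) (fun p ↦ p + 1) ?_ ?_ ?_ ?_ ?_
    · intro p hp; rw [Finset.mem_Icc] at hp ⊢; omega
    · intro p hp; rw [Finset.mem_Icc] at hp ⊢; omega
    · intro p _; ring
    · intro p _; ring
    · intro p _; rw [sub_add_cancel]
  rw [h1, ← Finset.sum_add_distrib, Finset.mul_sum]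
  refine Finset.sum_congr rfl fun p _ ↦ ?_
  rw [dz_coeff, dz_coeff, add_sub_cancel_right, show k - (p + 1) = k - 1 - p by ring,
    show k - p - 1 = k - 1 - p by ring]
  push_cast
  ring

theorem mdz_mul (M N : Matrix (Fin n) (Fin n) K) : mdz (M * N) = mdz M * N + M * mdz N := by
  ext1 i j
  simp only [mdz_apply, Matrix.mul_apply, Matrix.add_apply, map_sum, dz_mul,
    Finset.sum_add_distrib]

theorem cf_mdz (m : ℤ) (M : Matrix (Fin n) (Fin n) K) :
    cf m (mdz M) = ((1 - m : ℤ) : ℂ) • cf (m - 1) M := by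
  ext i j
  exact dz_coeff _ _

theorem mdz_mem_fil {M : Matrix (Fin n) (Fin n) K} {a : ℤ} (hM : M ∈ fil n a) :
    mdz M ∈ fil n (a + 1) := fun m hm ↦ by
  rw [cf_mdz, hM _ (by omega), smul_zero]

/-- The matrix `z ^ (-k) A`. -/
def sgl (k : ℤ) (A : Matrix (Fin n) (Fin n) ℂ) : Matrix (Fin n) (Fin n) K :=
  Matrix.of fun i j ↦ HahnSeries.single k (A i j)

theorem cf_sgl (k m : ℤ) (A : Matrix (Fin n) (Fin n) ℂ) :
    cf m (sgl k A) = if m = k then A else 0 := by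
  ext i j
  rw [cf_apply, sgl, Matrix.of_apply, HahnSeries.coeff_single]
  split_ifs <;> rfl

theorem sgl_mem_fil (k : ℤ) (A : Matrix (Fin n) (Fin n) ℂ) : sgl k A ∈ fil n k := fun m hm ↦ by
  rw [cf_sgl, if_neg hm.ne]

theorem cf_lie_sgl (k m : ℤ) (A : Matrix (Fin n) (Fin n) ℂ) (M : Matrix (Fin n) (Fin n) K) :
    cf m ⁅sgl k A, M⁆ = ⁅A, cf (m - k) M⁆ := by
  obtain ⟨c, hc⟩ := exists_mem_fil M
  -- The bound for `M` is lowered to at most `m - k` so that the one contributing index `p = k` lies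
  -- in the interval.
  rw [cf_lie (sgl_mem_fil k A) (fil_anti (min_le_left c (m - k)) hc),
    Finset.sum_eq_single_of_mem k (Finset.mem_Icc.mpr ⟨le_rfl, by
      have := min_le_right c (m - k); omega⟩)]
  · rw [cf_sgl, if_pos rfl]
  · intro p _ hp
    rw [cf_sgl, if_neg hp, zero_lie]

section Act

variable {𝔤 : Type*} [LieRing 𝔤] [LieAlgebra ℂ 𝔤] (π : 𝔤 →ₗ⁅ℂ⁆ Matrix (Fin n) (Fin n) ℂ)

theorem cf_act (x : HahnSeries ℤ 𝔤) (m : ℤ) : cf m (act π x) = π (x.coeff m) := by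
  ext i j
  rfl

theorem act_add (x y : HahnSeries ℤ 𝔤) : act π (x + y) = act π x + act π y :=
  ext_cf fun m ↦ by rw [map_add, cf_act, cf_act, cf_act, HahnSeries.coeff_add, map_add]

theorem act_single (k : ℤ) (x : 𝔤) : act π (HahnSeries.single k x) = sgl k (π x) :=
  ext_cf fun m ↦ by
    rw [cf_act, cf_sgl, HahnSeries.coeff_single]
    split_ifs
    · rfl
    · exact map_zero π

end Act

end MatrixCoefficients

/-! ### The principal filtration and lifts from `𝔤` to the loop algebra. -/

namespace CyclicGrading

section PrincipalFiltration

variable {𝔤 : Type*} [LieRing 𝔤] [LieAlgebra ℂ 𝔤] (G : CyclicGrading 𝔤) {n : ℕ}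
  (π : 𝔤 →ₗ⁅ℂ⁆ Matrix (Fin n) (Fin n) ℂ)

theorem P_eq_zero_of_abs {f : ℤ} (hf : G.h ≤ |f|) (x : 𝔤) : G.P f x = 0 :=
  G.P_of_le f x <| by
    rcases le_abs'.mp hf with h | h
    · exact Or.inl h
    · exact Or.inr h

theorem eq_zero_of_forall_P {x : 𝔤} (h : ∀ f, G.P f x = 0) : x = 0 := by
  rw [← G.sum_P x]
  exact Finset.sum_eq_zero fun f _ ↦ h f

/-- The sum of the components of degree at most `e`. -/
def gle (e : ℤ) : Submodule ℂ 𝔤 where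
  carrier := {x | ∀ f, e < f → G.P f x = 0}
  add_mem' hx hy f hf := by rw [map_add, hx f hf, hy f hf, add_zero]
  zero_mem' f _ := map_zero _
  smul_mem' c x hx f hf := by rw [map_smul, hx f hf, smul_zero]

theorem gle_mono {e e' : ℤ} (h : e ≤ e') : G.gle e ≤ G.gle e' :=
  fun _ hx f hf ↦ hx f (h.trans_lt hf)

theorem eq_zero_of_mem_gle {e : ℤ} (he : e ≤ -G.h) {x : 𝔤} (hx : x ∈ G.gle e) : x = 0 :=
  G.eq_zero_of_forall_P fun f ↦ by
    by_cases h : e < f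
    · exact hx f h
    · exact G.P_of_le f x (Or.inl (by omega))

theorem mem_gle_of_lie_eq {e : ℤ} {x : 𝔤} (hx : ⁅G.ρ, x⁆ = (e : ℂ) • x) : x ∈ G.gle e :=
  fun f hf ↦ G.P_of_ne f e x hx hf.ne

theorem lie_mem_gle {a c : ℤ} {x y : 𝔤} (hx : x ∈ G.gle a) (hy : y ∈ G.gle c) :
    ⁅x, y⁆ ∈ G.gle (a + c) := by
  rw [← G.sum_P x, sum_lie]
  refine Submodule.sum_mem _ fun d _ f hf ↦ ?_
  rw [G.P_lie (G.lie_P d x)]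
  by_cases h : a < d
  · rw [hx d h, zero_lie]
  · rw [hy (f - d) (by omega), lie_zero]

/-- The elements of the loop algebra all of whose components have principal degree at most `d`. -/
def pfil (d : ℤ) : Submodule ℂ (Matrix (Fin n) (Fin n) K) where
  carrier := {M | ∀ m : ℤ, ∃ x ∈ G.gle (d + G.h * m), cf m M = π x}
  add_mem' hM hN m := by
    obtain ⟨x, hx, hx'⟩ := hM m
    obtain ⟨y, hy, hy'⟩ := hN m
    exact ⟨x + y, add_mem hx hy, by rw [map_add, hx', hy', map_add]⟩
  zero_mem' m := ⟨0, zero_mem _, by rw [map_zero, map_zero]⟩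
  smul_mem' c M hM m := by
    obtain ⟨x, hx, hx'⟩ := hM m
    exact ⟨c • x, Submodule.smul_mem _ _ hx, by rw [map_smul, hx', map_smul]⟩

variable {π}

theorem pfil_mono {d d' : ℤ} (h : d ≤ d') : G.pfil π d ≤ G.pfil π d' := fun _ hM m ↦ by
  obtain ⟨x, hx, hx'⟩ := hM m
  exact ⟨x, G.gle_mono (by omega) hx, hx'⟩

theorem cf_eq_zero_of_mem_pfil {d m : ℤ} (hm : d + G.h * m ≤ -G.h)
    {M : Matrix (Fin n) (Fin n) K} (hM : M ∈ G.pfil π d) : cf m M = 0 := by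
  obtain ⟨x, hx, hx'⟩ := hM m
  rw [hx', G.eq_zero_of_mem_gle hm hx, map_zero]

theorem pfil_le_fil {d N : ℤ} (h : d + G.h * N ≤ 0) : G.pfil π d ≤ fil n N :=
  fun _ hM m hm ↦ G.cf_eq_zero_of_mem_pfil (by have := G.two_le_h; nlinarith) hM

theorem exists_pfil_le_fil (d : ℤ) : ∃ N, G.pfil π d ≤ fil n N :=
  ⟨-|d|, G.pfil_le_fil (by
    have := G.two_le_h
    have := le_abs_self d
    have := abs_nonneg d
    nlinarith)⟩

theorem lie_mem_pfil {a c : ℤ} {M N : Matrix (Fin n) (Fin n) K} (hM : M ∈ G.pfil π a)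
    (hN : N ∈ G.pfil π c) : ⁅M, N⁆ ∈ G.pfil π (a + c) := by
  intro m
  obtain ⟨a', ha'⟩ := G.exists_pfil_le_fil (π := π) a
  obtain ⟨c', hc'⟩ := G.exists_pfil_le_fil (π := π) c
  have hMf := ha' hM
  have hNf := hc' hN
  choose x hx hx' using hM
  choose y hy hy' using hN
  refine ⟨∑ p ∈ Finset.Icc a' (m - c'), ⁅x p, y (m - p)⁆, Submodule.sum_mem _ fun p _ ↦ ?_, ?_⟩
  · have := G.lie_mem_gle (hx p) (hy (m - p))
    rwa [show a + G.h * p + (c + G.h * (m - p)) = a + c + G.h * m by ring] at this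
  · rw [cf_lie hMf hNf, map_sum]
    refine Finset.sum_congr rfl fun p _ ↦ ?_
    rw [hx', hy', LieHom.map_lie]

theorem mdz_mem_pfil {d : ℤ} {M : Matrix (Fin n) (Fin n) K} (hM : M ∈ G.pfil π d) :
    mdz M ∈ G.pfil π (d - G.h) := by
  intro m
  obtain ⟨x, hx, hx'⟩ := hM (m - 1)
  refine ⟨((1 - m : ℤ) : ℂ) • x, Submodule.smul_mem _ _ ?_, by rw [cf_mdz, hx', map_smul]⟩
  rwa [show d - G.h + G.h * m = d + G.h * (m - 1) by ring]

theorem sgl_mem_pfil {d k : ℤ} {x : 𝔤} (hx : x ∈ G.gle (d + G.h * k)) :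
    sgl k (π x) ∈ G.pfil π d := by
  intro m
  rw [cf_sgl]
  split_ifs with h
  · subst h; exact ⟨x, hx, rfl⟩
  · exact ⟨0, zero_mem _, (map_zero π).symm⟩

/-- Only finitely many powers of `z` occur in a given principal degree: index `m` requires a vector
of degree `d + h m`, and such degrees lie strictly between `-h` and `h`. -/
theorem lt_of_abs_le (d m : ℤ) (hm : |d| + 2 ≤ |m|) : G.h ≤ |d + G.h * m| := by
  have h2 := G.two_le_h
  have h1 : |G.h * m| = G.h * |m| := by rw [abs_mul, abs_of_nonneg (by omega)]
  have h3 : |G.h * m| - |d| ≤ |d + G.h * m| := by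
    have := abs_sub_abs_le_abs_sub (G.h * m) (-d)
    rw [abs_neg, sub_neg_eq_add, add_comm (G.h * m)] at this
    exact this
  have h4 := abs_nonneg d
  nlinarith

variable (π) in
theorem exists_lift (d : ℤ) (x : 𝔤) : ∃ M : Matrix (Fin n) (Fin n) K,
    ∀ m, cf m M = π (G.P (d + G.h * m) x) :=
  exists_cf_eq (N := -(|d| + 2)) _ fun m hm ↦ by
    rw [G.P_eq_zero_of_abs, map_zero]
    refine G.lt_of_abs_le d m ?_
    rw [abs_of_neg (a := m) (by have := abs_nonneg d; omega)]
    omega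

variable (π) in
/-- The lift of `x ∈ 𝔤` to the component of principal degree `d`: the sum of the components of
`x` of degree congruent to `d` modulo `h`, each with the appropriate power of `z`. -/
def lift (d : ℤ) (x : 𝔤) : Matrix (Fin n) (Fin n) K := (G.exists_lift π d x).choose

theorem cf_lift (d m : ℤ) (x : 𝔤) : cf m (G.lift π d x) = π (G.P (d + G.h * m) x) :=
  (G.exists_lift π d x).choose_spec m

theorem lift_add (d : ℤ) (x y : 𝔤) : G.lift π d (x + y) = G.lift π d x + G.lift π d y :=
  ext_cf fun m ↦ by simp only [map_add, cf_lift]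

theorem lift_smul (d : ℤ) (a : ℂ) (x : 𝔤) : G.lift π d (a • x) = a • G.lift π d x :=
  ext_cf fun m ↦ by simp only [map_smul, cf_lift]

theorem lift_neg (d : ℤ) (x : 𝔤) : G.lift π d (-x) = -G.lift π d x :=
  ext_cf fun m ↦ by simp only [map_neg, cf_lift]

theorem lift_sub (d : ℤ) (x y : 𝔤) : G.lift π d (x - y) = G.lift π d x - G.lift π d y :=
  ext_cf fun m ↦ by simp only [map_sub, cf_lift]

theorem lift_eq_sgl {d k : ℤ} {x : 𝔤} (hx : ⁅G.ρ, x⁆ = ((d + G.h * k : ℤ) : ℂ) • x) :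
    G.lift π d x = sgl k (π x) := by
  refine ext_cf fun m ↦ ?_
  rw [cf_lift, cf_sgl]
  split_ifs with h
  · rw [h, G.P_self _ _ hx]
  · rw [G.P_of_ne _ _ _ hx, map_zero]
    intro h'
    exact h (mul_left_cancel₀ (by have := G.two_le_h; omega : G.h ≠ 0) (by linarith))

theorem lift_zero (d : ℤ) : G.lift π d 0 = 0 :=
  ext_cf fun m ↦ by simp only [map_zero, cf_lift]

theorem lift_mem_pfil (d : ℤ) (x : 𝔤) : G.lift π d x ∈ G.pfil π d := fun m ↦
  ⟨_, G.mem_gle_of_lie_eq (G.lie_P _ x), G.cf_lift d m x⟩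

/-- The leading part of degree `d` is a lift: its coefficients have the distinct degrees `d + h m`,
so they can be summed in `𝔤` and recovered by projection. -/
theorem exists_sub_lift_mem_pfil {d : ℤ} {M : Matrix (Fin n) (Fin n) K} (hM : M ∈ G.pfil π d) :
    ∃ x, M - G.lift π d x ∈ G.pfil π (d - 1) := by
  have h2 := G.two_le_h
  choose x hx hx' using hM
  set I := Finset.Icc (-(|d| + 2)) (|d| + 2)
  refine ⟨∑ m ∈ I, G.P (d + G.h * m) (x m), fun k ↦ ?_⟩
  have hP : G.P (d + G.h * k) (∑ m ∈ I, G.P (d + G.h * m) (x m)) = G.P (d + G.h * k) (x k) := by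
    rw [map_sum]
    simp_rw [G.P_P]
    by_cases hk : k ∈ I
    · rw [Finset.sum_eq_single_of_mem k hk, if_pos rfl]
      intro m _ hmk
      refine if_neg fun h ↦ hmk ?_
      exact mul_left_cancel₀ (by omega : G.h ≠ 0) (by linarith)
    · have habs : |d| + 2 ≤ |k| := by
        rw [Finset.mem_Icc, ← abs_le] at hk
        omega
      rw [G.P_eq_zero_of_abs (G.lt_of_abs_le d k habs)]
      refine Finset.sum_eq_zero fun m hm ↦ if_neg fun h ↦ hk ?_
      have : m = k := mul_left_cancel₀ (by omega : G.h ≠ 0) (by linarith)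
      exact this ▸ hm
  refine ⟨x k - G.P (d + G.h * k) (x k), fun f hf ↦ ?_, ?_⟩
  · rw [map_sub, G.P_P]
    split_ifs with h
    · rw [h, sub_self]
    · rw [hx k f (by omega), sub_zero]
  · rw [map_sub, hx', cf_lift, hP, map_sub]

/-- The principal degree derivation is `h z ∂_z + ad ρ`; this is its action on an element of degree
`d`, divided by `z`. -/
theorem mdz_lift (d : ℤ) (x : 𝔤) : (G.h : ℂ) • mdz (G.lift π d x) =
    (d : ℂ) • G.lift π (d - G.h) x - G.lift π (d - G.h) ⁅G.ρ, x⁆ := by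
  refine ext_cf fun m ↦ ?_
  have h1 : G.P (d - G.h + G.h * m) ⁅G.ρ, x⁆ =
      ((d - G.h + G.h * m : ℤ) : ℂ) • G.P (d - G.h + G.h * m) x := by
    have h0 : ⁅G.ρ, G.ρ⁆ = ((0 : ℤ) : ℂ) • G.ρ := by simp
    rw [G.P_lie h0, sub_zero, G.lie_P]
  rw [map_smul, cf_mdz, cf_lift, map_sub, map_smul, cf_lift, cf_lift, h1, map_smul, smul_smul,
    ← sub_smul, show d + G.h * (m - 1) = d - G.h + G.h * m by ring]
  congr 1
  push_cast
  ring

theorem lie_sgl_lift {a k : ℤ} {y : 𝔤} (hy : ⁅G.ρ, y⁆ = ((a + G.h * k : ℤ) : ℂ) • y)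
    (d : ℤ) (x : 𝔤) :
    ⁅sgl k (π y), G.lift π d x⁆ = G.lift π (a + d) ⁅y, x⁆ := by
  refine ext_cf fun m ↦ ?_
  rw [cf_lie_sgl, cf_lift, cf_lift, G.P_lie hy, LieHom.map_lie]
  congr 4
  ring

variable (π) in
/-- The cyclic element `Λ_{1,z}`. -/
def lam : Matrix (Fin n) (Fin n) K := sgl 0 (π G.e) + sgl (-1) (π G.E)

theorem lam_mem_pfil : G.lam π ∈ G.pfil π 1 := by
  refine add_mem (G.sgl_mem_pfil (G.mem_gle_of_lie_eq ?_)) (G.sgl_mem_pfil (G.mem_gle_of_lie_eq ?_))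
  · rw [mul_zero, add_zero]; exact G.lie_e'
  · rw [mul_neg_one, ← sub_eq_add_neg]; exact G.lie_E

theorem lie_lam_lift (d : ℤ) (x : 𝔤) :
    ⁅G.lam π, G.lift π d x⁆ = G.lift π (1 + d) ⁅G.cyc, x⁆ := by
  rw [lam, add_lie, G.lie_sgl_lift (a := 1), G.lie_sgl_lift (a := 1), cyc, add_lie, lift_add]
  · rw [mul_neg_one, ← sub_eq_add_neg]; exact G.lie_E
  · rw [mul_zero, add_zero]; exact G.lie_e'

end PrincipalFiltration

end CyclicGrading

/-! ### The gauge action as a series of iterated commutators. -/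

section Tower

variable {n : ℕ}

/-- The iterated commutators of the operator `∂_z + B` with `X`. -/
def tower (B X : Matrix (Fin n) (Fin n) K) : ℕ → Matrix (Fin n) (Fin n) K
  | 0 => B
  | 1 => mdz X + ⁅B, X⁆
  | k + 2 => ⁅tower B X (k + 1), X⁆

/-- The partial sums of `exp (-ad X) (∂_z + B) - ∂_z`. -/
def gauge (B X : Matrix (Fin n) (Fin n) K) (k : ℕ) : Matrix (Fin n) (Fin n) K :=
  ∑ j ∈ Finset.range k, (j.factorial : ℂ)⁻¹ • tower B X j

theorem sum_range_sub_sum_range_mem {M : Type*} [AddCommGroup M] [Module ℂ M] (W : Submodule ℂ M)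
    (f : ℕ → M) {k₀ k : ℕ} (hk : k₀ ≤ k) (hf : ∀ j, k₀ ≤ j → f j ∈ W) :
    ∑ j ∈ Finset.range k, f j - ∑ j ∈ Finset.range k₀, f j ∈ W := by
  induction k, hk using Nat.le_induction with
  | base => rw [sub_self]; exact zero_mem _
  | succ k hk ih =>
    rw [Finset.sum_range_succ, add_sub_right_comm]
    exact add_mem ih (hf k hk)

end Tower

namespace CyclicGrading

section Dressing

variable {𝔤 : Type*} [LieRing 𝔤] [LieAlgebra ℂ 𝔤] (G : CyclicGrading 𝔤) {n : ℕ}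
  {π : 𝔤 →ₗ⁅ℂ⁆ Matrix (Fin n) (Fin n) ℂ} {B X Y : Matrix (Fin n) (Fin n) K}

/-- Each commutator with `X` lowers the degree by `h + 1`, and `∂_z X` is lower still than `[B, X]`
requires. -/
theorem tower_mem_pfil (hB : B ∈ G.pfil π 1) (hX : X ∈ G.pfil π (-G.h - 1)) :
    ∀ k : ℕ, tower B X k ∈ G.pfil π (1 - k * (G.h + 1))
  | 0 => by simpa [tower] using hB
  | 1 => by
    have := G.two_le_h
    exact add_mem (G.pfil_mono (by push_cast; linarith) (G.mdz_mem_pfil hX))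
      (G.pfil_mono (by push_cast; linarith) (G.lie_mem_pfil hB hX))
  | k + 2 => G.pfil_mono (by push_cast; linarith)
      (G.lie_mem_pfil (tower_mem_pfil hB hX (k + 1)) hX)

theorem tower_mem_pfil_of_le (hB : B ∈ G.pfil π 1) (hX : X ∈ G.pfil π (-G.h - 1)) {k₀ k : ℕ}
    (hk : k₀ ≤ k) : tower B X k ∈ G.pfil π (1 - k₀ * (G.h + 1)) := by
  refine G.pfil_mono ?_ (G.tower_mem_pfil hB hX k)
  have := G.two_le_h
  have : (k₀ : ℤ) ≤ k := by exact_mod_cast hk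
  nlinarith

theorem gauge_sub_gauge_mem_pfil (hB : B ∈ G.pfil π 1) (hX : X ∈ G.pfil π (-G.h - 1)) {k₀ k : ℕ}
    (hk : k₀ ≤ k) : gauge B X k - gauge B X k₀ ∈ G.pfil π (1 - k₀ * (G.h + 1)) :=
  sum_range_sub_sum_range_mem _ _ hk fun _ hj ↦
    Submodule.smul_mem _ _ (G.tower_mem_pfil_of_le hB hX hj)

theorem gauge_add_sub_gauge (B X Y : Matrix (Fin n) (Fin n) K) (k : ℕ) :
    gauge B (X + Y) k - gauge B X k =
      ∑ j ∈ Finset.range k, (j.factorial : ℂ)⁻¹ • (tower B (X + Y) j - tower B X j) := by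
  simp only [gauge, smul_sub, Finset.sum_sub_distrib]

theorem tower_one_sub (B X Y : Matrix (Fin n) (Fin n) K) :
    tower B (X + Y) 1 - tower B X 1 = mdz Y + ⁅B, Y⁆ := by
  simp only [tower, map_add, lie_add]
  abel

theorem tower_succ_sub (B X Y : Matrix (Fin n) (Fin n) K) (k : ℕ) :
    tower B (X + Y) (k + 2) - tower B X (k + 2) =
      ⁅tower B (X + Y) (k + 1) - tower B X (k + 1), X + Y⁆ + ⁅tower B X (k + 1), Y⁆ := by
  simp only [tower, sub_lie, lie_add]
  abel

variable {d : ℤ}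

theorem tower_one_sub_mem_pfil (hB : B ∈ G.pfil π 1) (hY : Y ∈ G.pfil π d) :
    tower B (X + Y) 1 - tower B X 1 ∈ G.pfil π (d + 1) := by
  have := G.two_le_h
  rw [tower_one_sub]
  exact add_mem (G.pfil_mono (by omega) (G.mdz_mem_pfil hY))
    (G.pfil_mono (by omega) (G.lie_mem_pfil hB hY))

theorem tower_sub_mem_pfil (hB : B ∈ G.pfil π 1) (hX : X ∈ G.pfil π (-G.h - 1))
    (hd : d ≤ -G.h - 1) (hY : Y ∈ G.pfil π d) :
    ∀ k : ℕ, tower B (X + Y) (k + 2) - tower B X (k + 2) ∈ G.pfil π (d - G.h) := by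
  have h2 := G.two_le_h
  have hXY : X + Y ∈ G.pfil π (-G.h - 1) := add_mem hX (G.pfil_mono hd hY)
  have hT (k : ℕ) : tower B X (k + 1) ∈ G.pfil π (-G.h) :=
    G.pfil_mono (by push_cast; linarith) (G.tower_mem_pfil_of_le hB hX (Nat.le_add_left 1 k))
  intro k
  induction k with
  | zero =>
    rw [tower_succ_sub]
    exact add_mem (G.pfil_mono (by omega) (G.lie_mem_pfil (G.tower_one_sub_mem_pfil hB hY) hXY))
      (G.pfil_mono (by omega) (G.lie_mem_pfil (hT 0) hY))
  | succ k ih =>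
    rw [tower_succ_sub]
    exact add_mem (G.pfil_mono (by omega) (G.lie_mem_pfil ih hXY))
      (G.pfil_mono (by omega) (G.lie_mem_pfil (hT _) hY))

theorem sum_range_two (B X Y : Matrix (Fin n) (Fin n) K) :
    ∑ j ∈ Finset.range 2, (j.factorial : ℂ)⁻¹ • (tower B (X + Y) j - tower B X j) =
      mdz Y + ⁅B, Y⁆ := by
  rw [Finset.sum_range_succ, Finset.sum_range_one, tower_one_sub]
  simp [tower]

/-- A perturbation `Y` acts to first order by `[∂_z + B, Y]`. Every other term carries a further
bracket with `X + Y` or with a tower term of degree at most `-h`. -/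
theorem gauge_add_sub_mem_pfil (hB : B ∈ G.pfil π 1) (hX : X ∈ G.pfil π (-G.h - 1))
    (hd : d ≤ -G.h - 1) (hY : Y ∈ G.pfil π d) {k : ℕ} (hk : 2 ≤ k) :
    gauge B (X + Y) k - gauge B X k - (mdz Y + ⁅B, Y⁆) ∈ G.pfil π (d - G.h) := by
  rw [gauge_add_sub_gauge, ← sum_range_two B X Y]
  refine sum_range_sub_sum_range_mem _ _ hk fun j hj ↦ Submodule.smul_mem _ _ ?_
  obtain ⟨j, rfl⟩ := Nat.exists_eq_add_of_le' hj
  exact G.tower_sub_mem_pfil hB hX hd hY j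

theorem gauge_add_sub_mem_pfil' (hB : B ∈ G.pfil π 1) (hX : X ∈ G.pfil π (-G.h - 1))
    (hd : d ≤ -G.h - 1) (hY : Y ∈ G.pfil π d) {k : ℕ} (hk : 2 ≤ k) :
    gauge B (X + Y) k - gauge B X k ∈ G.pfil π (d + 1) := by
  have h2 := G.two_le_h
  have h1 := G.gauge_add_sub_mem_pfil hB hX hd hY hk
  rw [← tower_one_sub B X] at h1
  rw [← sub_add_cancel (gauge B (X + Y) k - gauge B X k) (tower B (X + Y) 1 - tower B X 1)]
  exact add_mem (G.pfil_mono (by omega) h1) (G.tower_one_sub_mem_pfil hB hY)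

variable {H : 𝔤}

theorem sgl_one_mem_pfil (hH : ⁅G.ρ, H⁆ = 0) : sgl 1 (π H) ∈ G.pfil π (-G.h) :=
  G.sgl_mem_pfil (G.mem_gle_of_lie_eq (by simpa using hH))

theorem lam_add_sgl_mem_pfil (hH : ⁅G.ρ, H⁆ = 0) : G.lam π + sgl 1 (π H) ∈ G.pfil π 1 :=
  add_mem G.lam_mem_pfil (G.pfil_mono (by have := G.two_le_h; omega) (G.sgl_one_mem_pfil hH))

theorem gauge_add_sub_lie_lam_mem_pfil (hH : ⁅G.ρ, H⁆ = 0) (hX : X ∈ G.pfil π (-G.h - 1))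
    (hd : d ≤ -G.h - 1) (hY : Y ∈ G.pfil π d) {k : ℕ} (hk : 2 ≤ k) :
    gauge (G.lam π + sgl 1 (π H)) (X + Y) k - gauge (G.lam π + sgl 1 (π H)) X k - ⁅G.lam π, Y⁆ ∈
      G.pfil π (d - G.h) := by
  have h1 := G.gauge_add_sub_mem_pfil (G.lam_add_sgl_mem_pfil hH) hX hd hY hk
  have h2 := G.lie_mem_pfil (G.sgl_one_mem_pfil hH) hY
  have h3 := add_mem h1 (add_mem (G.mdz_mem_pfil hY) (G.pfil_mono (by omega) h2))
  convert h3 using 1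
  rw [add_lie]
  abel

/-- When `Y` commutes with `Λ`, the first-order change is `∂_z Y + [H/z, Y]`. The quadratic term
contributes `½[T, Y]` with `T = tower B X 1`, and `T = -H/z` modulo lower degree by `hX1`; this
leaves half of `[H/z, Y]`. -/
theorem gauge_add_sub_of_lie_lam_eq_zero (hH : ⁅G.ρ, H⁆ = 0) (hX : X ∈ G.pfil π (-G.h - 1))
    (hX1 : tower (G.lam π + sgl 1 (π H)) X 1 + sgl 1 (π H) ∈ G.pfil π (-G.h - 1))
    (hd : d ≤ -G.h - 1) (hY : Y ∈ G.pfil π d) (hY0 : ⁅G.lam π, Y⁆ = 0) {k : ℕ} (hk : 3 ≤ k) :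
    gauge (G.lam π + sgl 1 (π H)) (X + Y) k - gauge (G.lam π + sgl 1 (π H)) X k -
      (mdz Y + (1 / 2 : ℂ) • ⁅sgl 1 (π H), Y⁆) ∈ G.pfil π (d - G.h - 1) := by
  have h2 := G.two_le_h
  set B := G.lam π + sgl 1 (π H) with hBd
  have hB : B ∈ G.pfil π 1 := G.lam_add_sgl_mem_pfil hH
  have hXY : X + Y ∈ G.pfil π (-G.h - 1) := add_mem hX (G.pfil_mono hd hY)
  have hη := G.sgl_one_mem_pfil (π := π) hH
  have hBY : ⁅B, Y⁆ = ⁅sgl 1 (π H), Y⁆ := by rw [hBd, add_lie, hY0, zero_add]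
  have hΔ1 : tower B (X + Y) 1 - tower B X 1 ∈ G.pfil π (d - G.h) := by
    rw [tower_one_sub, hBY]
    exact add_mem (G.mdz_mem_pfil hY) (G.pfil_mono (by omega) (G.lie_mem_pfil hη hY))
  have hΔ2 : tower B (X + Y) 2 - tower B X 2 + ⁅sgl 1 (π H), Y⁆ ∈ G.pfil π (d - G.h - 1) := by
    rw [tower_succ_sub, add_assoc, ← add_lie]
    exact add_mem (G.pfil_mono (by omega) (G.lie_mem_pfil hΔ1 hXY))
      (G.pfil_mono (by omega) (G.lie_mem_pfil hX1 hY))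
  have hΔ (j : ℕ) : tower B (X + Y) (j + 3) - tower B X (j + 3) ∈ G.pfil π (d - G.h - 1) := by
    rw [tower_succ_sub]
    refine add_mem (G.pfil_mono ?_
      (G.lie_mem_pfil (G.tower_sub_mem_pfil hB hX hd hY j) hXY))
      (G.pfil_mono ?_ (G.lie_mem_pfil (G.tower_mem_pfil_of_le hB hX (Nat.le_add_left 2 j)) hY))
    · omega
    · push_cast; omega
  have h3 := sum_range_sub_sum_range_mem (G.pfil π (d - G.h - 1))
    (fun j ↦ (j.factorial : ℂ)⁻¹ • (tower B (X + Y) j - tower B X j)) hk fun j hj ↦ by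
      obtain ⟨j, rfl⟩ := Nat.exists_eq_add_of_le' hj
      exact Submodule.smul_mem _ _ (hΔ j)
  rw [← gauge_add_sub_gauge, Finset.sum_range_succ, sum_range_two, hBY] at h3
  have h4 := add_mem h3 (Submodule.smul_mem _ (1 / 2 : ℂ) hΔ2)
  convert h4 using 1
  have : ((Nat.factorial 2 : ℕ) : ℂ)⁻¹ = 1 / 2 := by norm_num [Nat.factorial]
  rw [this]
  module

theorem tower_one_add_sgl_mem_pfil (hH : ⁅G.ρ, H⁆ = 0) (hX : X ∈ G.pfil π (-G.h - 1)) {k : ℕ}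
    (hk : 2 ≤ k)
    (hE : gauge (G.lam π + sgl 1 (π H)) X k - G.lam π ∈ G.pfil π (-G.h - 1)) :
    tower (G.lam π + sgl 1 (π H)) X 1 + sgl 1 (π H) ∈ G.pfil π (-G.h - 1) := by
  have h2 := G.two_le_h
  have h1 := G.gauge_sub_gauge_mem_pfil (G.lam_add_sgl_mem_pfil hH) hX hk
  have h3 := sub_mem hE (G.pfil_mono (by push_cast; omega) h1)
  convert h3 using 1
  rw [gauge, gauge, Finset.sum_range_succ _ 1, Finset.sum_range_one]
  simp [tower]
  abel

variable [FiniteDimensional ℂ 𝔤] [LieAlgebra.IsKilling ℂ 𝔤]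

/-- One degree of the error is removed by `S + C`: `S` commutes with `Λ` and cancels the centralizer
part through `∂_z`; `C` cancels the part in the image of `ad Λ`, including what `S` creates there.
The bound on `N` puts `d = h - N` at or below `-h - 1`, so `d ≠ 0` and `X` keeps its degree. -/
theorem exists_dressing_step (hH : ⁅G.ρ, H⁆ = 0) (hX : X ∈ G.pfil π (-G.h - 1)) {k : ℕ} (hk : 3 ≤ k)
    {N : ℤ} (hN : 2 * G.h + 1 ≤ N)
    (hE : gauge (G.lam π + sgl 1 (π H)) X k - G.lam π ∈ G.pfil π (-N)) :
    ∃ Y ∈ G.pfil π (G.h - N),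
      gauge (G.lam π + sgl 1 (π H)) (X + Y) k - G.lam π ∈ G.pfil π (-N - 1) := by
  have h2 := G.two_le_h
  have hX1 := G.tower_one_add_sgl_mem_pfil hH hX (by omega) (G.pfil_mono (by omega) hE)
  obtain ⟨x, hx⟩ := G.exists_sub_lift_mem_pfil hE
  obtain ⟨u, s, rfl, hs⟩ := G.exists_eq_lie_cyc_add x
  obtain ⟨u₁, hu₁⟩ := G.exists_lie_cyc_eq_lie (H := G.ρ) (lie_self _) hs
  obtain ⟨u₂, hu₂⟩ := G.exists_lie_cyc_eq_lie hH hs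
  set d := G.h - N with hd
  have hd0 : (d : ℂ) ≠ 0 := by
    have : d ≠ 0 := by omega
    exact_mod_cast this
  have hh0 : (G.h : ℂ) ≠ 0 := by
    have : G.h ≠ 0 := by omega
    exact_mod_cast this
  -- `∂_z` multiplies the `s`-part of the lift by `d / h`, so this `c` turns it into `-s`.
  set c : ℂ := -(G.h / d) with hc
  set S := G.lift π d (c • s) with hS
  have hSm : S ∈ G.pfil π d := G.lift_mem_pfil _ _
  have hS0 : ⁅G.lam π, S⁆ = 0 := by rw [lie_lam_lift, lie_smul, hs, smul_zero, lift_zero]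
  have hXS : X + S ∈ G.pfil π (-G.h - 1) := add_mem hX (G.pfil_mono (by omega) hSm)
  have h3 := G.gauge_add_sub_of_lie_lam_eq_zero hH hX hX1 (by omega) hSm hS0 hk
  have hdh : d - G.h = -N := by omega
  have hdS : mdz S = -G.lift π (-N) s - (c / G.h) • G.lift π (-N) ⁅G.cyc, u₁⁆ := by
    have h4 := G.mdz_lift (π := π) d (c • s)
    rw [← hS, hdh, lie_smul, G.lift_smul (-N) c s, G.lift_smul (-N) c, ← hu₁] at h4
    have h5 : mdz S = (G.h : ℂ)⁻¹ • ((G.h : ℂ) • mdz S) := by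
      rw [smul_smul, inv_mul_cancel₀ hh0, one_smul]
    rw [h5, h4, hc]
    match_scalars <;> field_simp
  have hηS : ⁅sgl 1 (π H), S⁆ = c • G.lift π (-N) ⁅G.cyc, u₂⁆ := by
    rw [G.lie_sgl_lift (a := -G.h) (by simpa using hH), lie_smul, lift_smul, hu₂,
      show -G.h + d = -N by omega]
  set v := u - (c / G.h) • u₁ + (1 / 2 * c) • u₂ with hv
  set C := G.lift π (-N - 1) (-v) with hC
  have hCm : C ∈ G.pfil π (-N - 1) := G.lift_mem_pfil _ _
  have h6 := G.gauge_add_sub_lie_lam_mem_pfil hH hXS (by omega) hCm (by omega : 2 ≤ k)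
  refine ⟨S + C, add_mem hSm (G.pfil_mono (by omega) hCm), ?_⟩
  rw [← add_assoc]
  have h7 : ⁅G.lam π, C⁆ = -(G.lift π (-N) ⁅G.cyc, u⁆ - (c / G.h) • G.lift π (-N) ⁅G.cyc, u₁⁆ +
      (1 / 2 * c) • G.lift π (-N) ⁅G.cyc, u₂⁆) := by
    rw [hC, lie_lam_lift, hv, show 1 + (-N - 1) = -N by ring]
    simp only [lie_neg, lie_smul, lie_add, lie_sub, lift_smul, lift_add, lift_sub, lift_neg]
  rw [hdS, hηS] at h3
  rw [h7] at h6
  rw [lift_add] at hx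
  have h8 := add_mem (add_mem (G.pfil_mono (by omega : -N - 1 - G.h ≤ -N - 1) h6)
    (G.pfil_mono (by omega : d - G.h - 1 ≤ -N - 1) h3)) hx
  convert h8 using 1
  module

-- The coefficient of index `m` is constant from step `d + h m + h` on, since later corrections
-- there would have degree at most `-h`.
omit [FiniteDimensional ℂ 𝔤] [LieAlgebra.IsKilling ℂ 𝔤] in
theorem exists_limit {Y : ℕ → Matrix (Fin n) (Fin n) K}
    (hY0 : Y 0 ∈ G.pfil π d) (hY : ∀ j : ℕ, Y (j + 1) - Y j ∈ G.pfil π (d - j)) :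
    ∃ X : Matrix (Fin n) (Fin n) K, ∀ j : ℕ, X - Y j ∈ G.pfil π (d - j) := by
  have h2 := G.two_le_h
  have hle {i j : ℕ} (hij : i ≤ j) : Y j - Y i ∈ G.pfil π (d - i) := by
    induction j, hij using Nat.le_induction with
    | base => rw [sub_self]; exact zero_mem _
    | succ j hj ih =>
      rw [← sub_add_sub_cancel (Y (j + 1)) (Y j) (Y i)]
      exact add_mem (G.pfil_mono (by omega) (hY j)) ih
  set J : ℤ → ℕ := fun m ↦ (d + G.h * m + G.h).toNat with hJ
  obtain ⟨X, hX⟩ := exists_cf_eq (n := n) (N := -|d| - 1) (fun m ↦ cf m (Y (J m))) fun m hm ↦ by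
    have h3 := le_abs_self d
    have h4 : d + G.h * m ≤ -G.h := by have := abs_nonneg d; nlinarith
    have : J m = 0 := by rw [hJ]; simp only; omega
    rw [this]
    exact G.cf_eq_zero_of_mem_pfil h4 hY0
  refine ⟨X, fun j m ↦ ?_⟩
  rw [map_sub, hX, ← map_sub]
  rcases le_total j (J m) with h | h
  · exact hle h m
  · have h3 : cf m (Y j - Y (J m)) = 0 :=
      G.cf_eq_zero_of_mem_pfil (by rw [hJ]; simp only; omega) (hle h)
    refine ⟨0, zero_mem _, ?_⟩
    rw [← neg_sub, map_neg, h3, neg_zero, map_zero]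

/-- The dressing element: `exp (-ad X) (∂_z + H / z + Λ) = ∂_z + Λ`. -/
theorem exists_dressing (hH : ⁅G.ρ, H⁆ = 0) : ∃ X ∈ G.pfil π (-G.h - 1),
    ∀ N : ℤ, ∃ k₀ : ℕ, ∀ k ≥ k₀, gauge (G.lam π + sgl 1 (π H)) X k - G.lam π ∈ fil n N := by
  have h2 := G.two_le_h
  set B := G.lam π + sgl 1 (π H) with hBd
  have hB : B ∈ G.pfil π 1 := G.lam_add_sgl_mem_pfil hH
  -- The first correction has degree `-h - 1` and leaves an error of degree `-2h - 1`; each further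
  -- step gains one. The lower bound on `k` makes the omitted commutators smaller than the error.
  let Q (j : ℕ) (X : Matrix (Fin n) (Fin n) K) : Prop := X ∈ G.pfil π (-G.h - 1) ∧
    ∀ k : ℕ, 2 * G.h + 2 + j ≤ k → gauge B X k - G.lam π ∈ G.pfil π (-(2 * G.h + 1 + j))
  obtain ⟨u, hu⟩ := G.exists_lie_cyc_eq_of_degree_zero hH
  have hQ0 : Q 0 (G.lift π (-G.h - 1) (-u)) := by
    refine ⟨G.lift_mem_pfil _ _, fun k hk ↦ ?_⟩
    have h1 := G.gauge_add_sub_lie_lam_mem_pfil (π := π) hH (zero_mem _) le_rfl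
      (G.lift_mem_pfil (-G.h - 1) (-u)) (k := k) (by omega)
    have h3 : gauge B 0 k = B := by
      obtain ⟨k, rfl⟩ : ∃ k', k = k' + 1 := ⟨k - 1, by omega⟩
      have h4 (j : ℕ) : tower B (0 : Matrix (Fin n) (Fin n) K) (j + 1) = 0 := by
        cases j <;> simp [tower]
      rw [gauge, Finset.sum_range_succ', Finset.sum_eq_zero fun j _ ↦ by
        rw [h4]; exact smul_zero (M := ℂ) (A := Matrix (Fin n) (Fin n) K) _]
      simp [tower]
    rw [zero_add, lie_lam_lift, lie_neg, hu, show 1 + (-G.h - 1) = -G.h by ring,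
      G.lift_neg (-G.h) H, G.lift_eq_sgl (d := -G.h) (k := 1) (by simpa using hH), ← hBd, h3,
      hBd] at h1
    refine G.pfil_mono (by push_cast; omega : -G.h - 1 - G.h ≤ _) ?_
    convert h1 using 1
    abel
  have hstep (j : ℕ) (X : Matrix (Fin n) (Fin n) K) (hX : Q j X) :
      ∃ Y ∈ G.pfil π (-G.h - 1 - j), Q (j + 1) (X + Y) := by
    set k₀ := (2 * G.h + 3 + j).toNat with hk₀
    obtain ⟨Y, hY, hXY⟩ := G.exists_dressing_step hH hX.1 (k := k₀) (by omega)
      (N := 2 * G.h + 1 + j) (by omega) (hX.2 k₀ (by omega))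
    rw [show G.h - (2 * G.h + 1 + j) = -G.h - 1 - j by ring] at hY
    have hXY' : X + Y ∈ G.pfil π (-G.h - 1) := add_mem hX.1 (G.pfil_mono (by omega) hY)
    refine ⟨Y, hY, hXY', fun k hk ↦ ?_⟩
    have h1 := G.gauge_sub_gauge_mem_pfil hB hXY' (show k₀ ≤ k by push_cast at hk; omega)
    rw [← sub_add_sub_cancel _ (gauge B (X + Y) k₀)]
    have hk₀' : (k₀ : ℤ) = 2 * G.h + 3 + j := by omega
    refine add_mem (G.pfil_mono ?_ h1) (G.pfil_mono (by push_cast; omega) hXY)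
    rw [hk₀']; push_cast; nlinarith
  choose! Y hY hQY using hstep
  let F : (j : ℕ) → {X : Matrix (Fin n) (Fin n) K // Q j X} := fun j ↦
    Nat.rec ⟨_, hQ0⟩ (fun j X ↦ ⟨X.1 + Y j X.1, hQY j X.1 X.2⟩) j
  have hF (j : ℕ) : (F (j + 1)).1 - (F j).1 ∈ G.pfil π (-G.h - 1 - j) := by
    have : (F (j + 1)).1 = (F j).1 + Y j (F j).1 := rfl
    rw [this, add_sub_cancel_left]
    exact hY j _ (F j).2
  obtain ⟨X, hX⟩ := G.exists_limit (Y := fun j ↦ (F j).1) (F 0).2.1 hF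
  have hXm : X ∈ G.pfil π (-G.h - 1) := by
    rw [← sub_add_cancel X (F 0).1]
    exact add_mem (G.pfil_mono (by omega) (hX 0)) (F 0).2.1
  refine ⟨X, hXm, fun N ↦ ?_⟩
  set j := (G.h * N).toNat with hj
  refine ⟨(2 * G.h + 2 + j).toNat, fun k hk ↦ ?_⟩
  refine G.pfil_le_fil (π := π) (d := -G.h - j) (by omega) ?_
  have h1 := G.gauge_add_sub_mem_pfil' hB (F j).2.1 (by omega) (hX j) (k := k) (by omega)
  rw [add_sub_cancel] at h1
  rw [← sub_add_sub_cancel _ (gauge B (F j).1 k)]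
  exact add_mem (G.pfil_mono (by omega) h1)
    (G.pfil_mono (by omega) ((F j).2.2 k (by omega)))

end Dressing

end CyclicGrading

/-! ### The exponential and the conjugation formula. -/

section FormalExp

variable {n : ℕ} {B X M N L μ : Matrix (Fin n) (Fin n) K}

theorem one_mem_fil : (1 : Matrix (Fin n) (Fin n) K) ∈ fil n 0 := by
  intro m hm
  ext i j
  rw [cf_apply, Matrix.one_apply]
  split_ifs
  · rw [HahnSeries.coeff_one, if_neg hm.ne]; rfl
  · rfl

theorem pow_mem_fil (hX : X ∈ fil n 1) (k : ℕ) : X ^ k ∈ fil n k := by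
  induction k with
  | zero => exact one_mem_fil
  | succ k ih =>
    rw [pow_succ]
    exact_mod_cast mul_mem_fil ih hX

/-- The partial sums of the exponential series. -/
def expSum (X : Matrix (Fin n) (Fin n) K) (k : ℕ) : Matrix (Fin n) (Fin n) K :=
  ∑ j ∈ Finset.range k, (j.factorial : ℂ)⁻¹ • X ^ j

theorem expSum_sub_mem_fil (hX : X ∈ fil n 1) {k₀ k : ℕ} (hk : k₀ ≤ k) :
    expSum X k - expSum X k₀ ∈ fil n k₀ :=
  sum_range_sub_sum_range_mem _ _ hk fun j hj ↦ Submodule.smul_mem _ _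
    (fil_anti (by exact_mod_cast hj) (pow_mem_fil hX j))

theorem expSum_mem_fil (hX : X ∈ fil n 1) (k : ℕ) : expSum X k ∈ fil n 0 := by
  have := expSum_sub_mem_fil hX (Nat.zero_le k)
  simpa [expSum] using this

theorem exists_formalExp (hX : X ∈ fil n 1) :
    ∃ μ, IsFormalExp X μ ∧ ∀ k : ℕ, μ - expSum X k ∈ fil n k := by
  -- Powers `X ^ j` with `j > m` do not reach index `m`, so `m + 1` terms determine that
  -- coefficient.
  obtain ⟨μ, hμ⟩ := exists_cf_eq (n := n) (N := 0) (fun m ↦ cf m (expSum X (m + 1).toNat))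
    fun m hm ↦ by
      have : (m + 1).toNat = 0 := by omega
      rw [this, expSum, Finset.sum_range_zero, map_zero]
  have h (k : ℕ) : μ - expSum X k ∈ fil n k := fun m hm ↦ by
    rw [map_sub, hμ, ← map_sub, ← neg_sub, map_neg,
      expSum_sub_mem_fil hX (show (m + 1).toNat ≤ k by omega) m (by omega), neg_zero]
  refine ⟨μ, fun i j m ↦ ?_, h⟩
  filter_upwards [eventually_ge_atTop (m + 1).toNat] with k hk
  have h1 := h k m (by omega)
  rw [map_sub, sub_eq_zero] at h1
  have h2 := congrFun (congrFun h1 i) j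
  rw [cf_apply, cf_apply, expSum, Matrix.sum_apply] at h2
  exact h2.symm

theorem smul_mul_eq (a : ℂ) (M N : Matrix (Fin n) (Fin n) K) : a • M * N = a • (M * N) := by
  obtain ⟨b, hb⟩ := exists_mem_fil M
  obtain ⟨c, hc⟩ := exists_mem_fil N
  refine ext_cf fun m ↦ ?_
  rw [map_smul, cf_mul hb hc, cf_mul (Submodule.smul_mem _ a hb) hc, Finset.smul_sum]
  exact Finset.sum_congr rfl fun p _ ↦ by rw [map_smul, smul_mul_assoc]

theorem mul_smul_eq (a : ℂ) (M N : Matrix (Fin n) (Fin n) K) : M * a • N = a • (M * N) := by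
  obtain ⟨b, hb⟩ := exists_mem_fil M
  obtain ⟨c, hc⟩ := exists_mem_fil N
  refine ext_cf fun m ↦ ?_
  rw [map_smul, cf_mul hb hc, cf_mul hb (Submodule.smul_mem _ a hc), Finset.smul_sum]
  exact Finset.sum_congr rfl fun p _ ↦ by rw [map_smul, mul_smul_comm]

theorem mdz_one : mdz (1 : Matrix (Fin n) (Fin n) K) = 0 := by
  have h := mdz_mul (1 : Matrix (Fin n) (Fin n) K) 1
  rw [mul_one, mul_one, one_mul] at h
  exact left_eq_add.mp h

/-- The zeroth tower term stands for `∂_z + B` with `∂_z` omitted, so its commutator with `X` misses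
`∂_z X`; hence the correction at `k = 0`. -/
theorem tower_mul (B X : Matrix (Fin n) (Fin n) K) (k : ℕ) :
    tower B X k * X = X * tower B X k + tower B X (k + 1) - if k = 0 then mdz X else 0 := by
  rcases k with _ | k
  · simp only [tower, Ring.lie_def, if_true]
    abel
  · simp only [tower, Ring.lie_def, Nat.add_eq_zero_iff, one_ne_zero, and_false, if_false]
    abel

theorem mdz_pow_add (B X : Matrix (Fin n) (Fin n) K) (m : ℕ) :
    mdz (X ^ m) + B * X ^ m =
      ∑ p ∈ Finset.HasAntidiagonal.antidiagonal m, m.choose p.1 • (X ^ p.1 * tower B X p.2) := by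
  induction m with
  | zero => simp [mdz_one, tower]
  | succ m ih =>
    rw [Finset.sum_antidiagonal_choose_succ_nsmul (fun j k ↦ X ^ j * tower B X k), pow_succ,
      mdz_mul, ← mul_assoc, add_right_comm, ← add_mul, ih, Finset.sum_mul]
    have h1 : ∀ p ∈ Finset.HasAntidiagonal.antidiagonal m,
        m.choose p.1 • (X ^ p.1 * tower B X p.2) * X =
        m.choose p.1 • (X ^ p.1 * tower B X (p.2 + 1)) +
        m.choose p.2 • (X ^ (p.1 + 1) * tower B X p.2) -
        -- The correction from `tower_mul` occurs only at `(m, 0)` and cancels the Leibniz term `X ^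
        -- m * mdz X`.
        (if p = (m, 0) then X ^ m * mdz X else 0) := by
      rintro ⟨i, j⟩ hp
      rw [Finset.HasAntidiagonal.mem_antidiagonal] at hp
      simp only at hp ⊢
      rw [Nat.choose_symm_of_eq_add (show m = i + j from hp.symm), smul_mul_assoc, mul_assoc,
        tower_mul, mul_sub, mul_add, smul_sub, smul_add, pow_succ, mul_assoc,
        add_comm (m.choose j • (X ^ i * (X * _)))]
      congr 1
      by_cases hj : j = 0
      · subst hj
        rw [add_zero] at hp
        subst hp
        simp
      · simp [hj]
    rw [Finset.sum_congr rfl h1, Finset.sum_sub_distrib, Finset.sum_add_distrib,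
      Finset.sum_ite_eq', if_pos (by simp), sub_add_cancel]

theorem smul_mdz_pow_add (B X : Matrix (Fin n) (Fin n) K) (m : ℕ) :
    (m.factorial : ℂ)⁻¹ • (mdz (X ^ m) + B * X ^ m) = ∑ p ∈ Finset.HasAntidiagonal.antidiagonal m,
      ((p.1.factorial : ℂ)⁻¹ • X ^ p.1) * ((p.2.factorial : ℂ)⁻¹ • tower B X p.2) := by
  rw [mdz_pow_add, Finset.smul_sum]
  refine Finset.sum_congr rfl fun p hp ↦ ?_
  rw [Finset.HasAntidiagonal.mem_antidiagonal] at hp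
  rw [smul_mul_eq, mul_smul_eq, smul_smul, ← Nat.cast_smul_eq_nsmul ℂ, smul_smul]
  congr 1
  have h := Nat.add_choose_mul_factorial_mul_factorial p.1 p.2
  have h1 : (p.1.factorial : ℂ) ≠ 0 := by exact_mod_cast p.1.factorial_ne_zero
  have h2 : (p.2.factorial : ℂ) ≠ 0 := by exact_mod_cast p.2.factorial_ne_zero
  have h3 : (m.factorial : ℂ) ≠ 0 := by exact_mod_cast m.factorial_ne_zero
  rw [hp] at h
  rw [← Nat.choose_symm_of_eq_add hp.symm] at h
  have h' : (m.choose p.1 : ℂ) * p.1.factorial * p.2.factorial = m.factorial := by exact_mod_cast h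
  field_simp
  linear_combination h'

theorem tower_mem_fil (hB : B ∈ fil n (-1)) (hX : X ∈ fil n 1) :
    ∀ k : ℕ, tower B X k ∈ fil n (k - 1)
  | 0 => by simpa [tower] using hB
  | 1 => add_mem (fil_anti (by norm_num) (mdz_mem_fil hX))
      (fil_anti (by norm_num) (lie_mem_fil hB hX))
  | k + 2 => fil_anti (by push_cast; linarith) (lie_mem_fil (tower_mem_fil hB hX (k + 1)) hX)

/-- The left side sums over the triangle `p + q < k` and the product over the square; the terms in
between have `p + q ≥ k`. -/
theorem mdz_expSum_add_sub_mem_fil (hB : B ∈ fil n (-1)) (hX : X ∈ fil n 1) (k : ℕ) :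
    mdz (expSum X k) + B * expSum X k - expSum X k * gauge B X k ∈ fil n (k - 1) := by
  set f : ℕ × ℕ → Matrix (Fin n) (Fin n) K := fun p ↦
    ((p.1.factorial : ℂ)⁻¹ • X ^ p.1) * ((p.2.factorial : ℂ)⁻¹ • tower B X p.2) with hf
  have h1 : mdz (expSum X k) + B * expSum X k =
      ∑ p ∈ (Finset.range k ×ˢ Finset.range k).filter (fun p ↦ p.1 + p.2 < k), f p := by
    rw [expSum, map_sum, Finset.mul_sum, ← Finset.sum_add_distrib]
    refine Eq.trans ?_ (Finset.sum_fiberwise_of_maps_to (t := Finset.range k)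
      (g := fun p : ℕ × ℕ ↦ p.1 + p.2) ?_ f)
    · refine Finset.sum_congr rfl fun m hm ↦ ?_
      rw [map_smul, mul_smul_eq]
      refine (smul_add (m.factorial : ℂ)⁻¹ (mdz (X ^ m)) (B * X ^ m)).symm.trans ?_
      rw [smul_mdz_pow_add]
      refine Finset.sum_congr ?_ fun _ _ ↦ rfl
      ext p
      rw [Finset.mem_range] at hm
      simp only [Finset.HasAntidiagonal.mem_antidiagonal, Finset.mem_filter,
        Finset.mem_product, Finset.mem_range]
      omega
    · intro p hp
      rw [Finset.mem_filter] at hp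
      exact Finset.mem_range.mpr hp.2
  have h2 : expSum X k * gauge B X k = ∑ p ∈ Finset.range k ×ˢ Finset.range k, f p := by
    rw [expSum, gauge, Finset.sum_mul_sum, Finset.sum_product]
  rw [h1, h2, ← Finset.sum_filter_add_sum_filter_not (Finset.range k ×ˢ Finset.range k)
    (fun p : ℕ × ℕ ↦ p.1 + p.2 < k) f, sub_add_cancel_left]
  refine neg_mem (Submodule.sum_mem _ fun p hp ↦ ?_)
  rw [Finset.mem_filter] at hp
  refine fil_anti ?_ (mul_mem_fil (Submodule.smul_mem _ _ (pow_mem_fil hX p.1))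
    (Submodule.smul_mem _ _ (tower_mem_fil hB hX p.2)))
  have : k ≤ p.1 + p.2 := not_lt.mp hp.2
  omega

theorem mdz_add_mul_eq (hB : B ∈ fil n (-1)) (hL : L ∈ fil n (-1)) (hX : X ∈ fil n 1)
    (hμ : ∀ k : ℕ, μ - expSum X k ∈ fil n k)
    (hg : ∀ N : ℤ, ∃ k₀ : ℕ, ∀ k ≥ k₀, gauge B X k - L ∈ fil n N) :
    mdz μ + B * μ = μ * L := by
  refine sub_eq_zero.mp (eq_zero_of_forall_mem_fil fun N ↦ ?_)
  obtain ⟨k₀, hk₀⟩ := hg N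
  -- One order is spare because `B` and `L` may contain the first power of `z`.
  set k := max k₀ (N + 1) with hk
  have hkN : N + 1 ≤ k := le_max_right _ _
  have h1 := hμ k
  have h : mdz μ + B * μ - μ * L = mdz (μ - expSum X k) + B * (μ - expSum X k) -
      (μ - expSum X k) * L + (mdz (expSum X k) + B * expSum X k - expSum X k * gauge B X k) +
      expSum X k * (gauge B X k - L) := by
    rw [map_sub]
    simp only [mul_sub, sub_mul]
    abel
  rw [h]
  refine add_mem (add_mem (sub_mem (add_mem ?_ ?_) ?_) ?_) ?_
  · exact fil_anti (by omega) (mdz_mem_fil h1)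
  · exact fil_anti (by omega) (mul_mem_fil hB h1)
  · exact fil_anti (by omega) (mul_mem_fil h1 hL)
  · exact fil_anti (by omega) (mdz_expSum_add_sub_mem_fil hB hX k)
  · exact fil_anti (by omega) (mul_mem_fil (expSum_mem_fil hX k) (hk₀ k (le_max_left _ _)))

end FormalExp

/-! ### Unipotent matrices and points of the Grassmannian. -/

section BigCell

variable {n : ℕ} {M B L μ : Matrix (Fin n) (Fin n) K} {v : Fin n → K}

theorem coeff_mulVec_eq_zero {a c m : ℤ} (hM : M ∈ fil n a)
    (hv : ∀ i, ∀ k < c, (v i).coeff k = 0) (hm : m < a + c) (i : Fin n) :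
    (M.mulVec v i).coeff m = 0 := by
  change (∑ j, M i j * v j).coeff m = 0
  rw [HahnSeries.coeff_sum]
  refine Finset.sum_eq_zero fun j _ ↦ ?_
  have h := coeff_mul_eq_sum_Icc (x := M i j) (fun k hk ↦ congrFun (congrFun (hM k hk) i) j)
    (hv j) m
  rw [Finset.Icc_eq_empty (by omega), Finset.sum_empty] at h
  exact h

theorem coeff_mulVec_eq {c m : ℤ} (hμ : μ - 1 ∈ fil n 1)
    (hv : ∀ i, ∀ k < c, (v i).coeff k = 0) (hm : m < 1 + c) (i : Fin n) :
    (μ.mulVec v i).coeff m = (v i).coeff m := by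
  have h := coeff_mulVec_eq_zero hμ hv hm i
  rw [Matrix.sub_mulVec, Matrix.one_mulVec, Pi.sub_apply, HahnSeries.coeff_sub] at h
  exact sub_eq_zero.mp h

theorem exists_forall_coeff_eq_zero (v : Fin n → K) : ∃ c : ℤ, ∀ i, ∀ k < c, (v i).coeff k = 0 := by
  choose N hN using fun i ↦ exists_coeff_eq_zero (v i)
  obtain ⟨c, hc⟩ := (Set.finite_range N).bddBelow
  exact ⟨c, fun i k hk ↦ hN i k (hk.trans_le (hc ⟨i, rfl⟩))⟩

/-- As `μ = 1 + O(1/z)`, the leading coefficients of `μ v` and `v` agree; vanishing thus propagates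
one power at a time. -/
theorem coeff_eq_zero_of_mulVec (hμ : μ - 1 ∈ fil n 1) {N : ℤ}
    (h : ∀ i, ∀ k < N, (μ.mulVec v i).coeff k = 0) : ∀ i, ∀ k < N, (v i).coeff k = 0 := by
  obtain ⟨c, hc⟩ := exists_forall_coeff_eq_zero v
  have key (t : ℕ) : ∀ i, ∀ k < min (c + t) N, (v i).coeff k = 0 := by
    induction t with
    | zero => exact fun i k hk ↦ hc i k (by have := (lt_min_iff.mp hk).1; simpa using this)
    | succ t ih =>
      intro i k hk
      rw [lt_min_iff] at hk
      rw [← coeff_mulVec_eq hμ ih (by push_cast at hk; omega) i, h i k hk.2]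
  exact fun i k hk ↦ key (k + 1 - c).toNat i k (lt_min (by omega) hk)

theorem isUnit_of_sub_one_mem_fil (hμ : μ - 1 ∈ fil n 1) : IsUnit μ := by
  refine Matrix.mulVec_injective_iff_isUnit.mp fun u v huv ↦ sub_eq_zero.mp ?_
  ext i k
  refine coeff_eq_zero_of_mulVec (N := k + 1) hμ (fun j m _ ↦ ?_) i k (lt_add_one k)
  have h : μ.mulVec (u - v) = 0 := by rw [Matrix.mulVec_sub, huv, sub_self]
  rw [h]
  rfl

theorem coeff_mul_eq_zero_of_pos {x y : K} (hx : ∀ k, 0 < k → x.coeff k = 0)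
    (hy : ∀ k, 0 < k → y.coeff k = 0) {m : ℤ} (hm : 0 < m) : (x * y).coeff m = 0 := by
  obtain ⟨a, ha⟩ := exists_coeff_eq_zero x
  obtain ⟨c, hc⟩ := exists_coeff_eq_zero y
  rw [coeff_mul_eq_sum_Icc ha hc]
  refine Finset.sum_eq_zero fun p _ ↦ ?_
  rcases lt_or_ge 0 p with hp | hp
  · rw [hx p hp, zero_mul]
  · rw [hy _ (by omega), mul_zero]

theorem z_smul_mem_Hplus (hv : v ∈ Hplus n) : z • v ∈ Hplus n := fun i _ hk ↦
  coeff_mul_eq_zero_of_pos (fun _ hm ↦ HahnSeries.coeff_single_of_ne (by omega)) (hv i) hk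

theorem connection_mem_Hplus (hL : ∀ m : ℤ, 0 < m → cf m L = 0) (hv : v ∈ Hplus n) :
    connection L v ∈ Hplus n := by
  refine add_mem (fun i k hk ↦ ?_) fun i k hk ↦ ?_
  · refine (dz_coeff (v i) k).trans ?_
    -- A derivative has no `z⁻¹` term: the factor `1 - k` vanishes at `k = 1`, the one index whose
    -- predecessor is not positive.
    rcases eq_or_ne k 1 with rfl | hk1
    · simp
    · rw [hv i _ (by omega), mul_zero]
  · change (∑ j, L i j * v j).coeff k = 0
    rw [HahnSeries.coeff_sum]
    exact Finset.sum_eq_zero fun j _ ↦ coeff_mul_eq_zero_of_pos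
      (fun m hm ↦ congrFun (congrFun (hL m hm) i) j) (hv j) hk

theorem connection_mulVec (h : mdz μ + B * μ = μ * L) (v : Fin n → K) :
    connection B (μ.mulVec v) = μ.mulVec (connection L v) := by
  have h1 (u : Fin n → K) (M : Matrix (Fin n) (Fin n) K) :
      connection M u = (fun i ↦ dz (u i)) + M.mulVec u := rfl
  have h2 : (fun i ↦ dz (μ.mulVec v i)) = (mdz μ).mulVec v + μ.mulVec fun i ↦ dz (v i) := by
    funext i
    change dz (∑ j, μ i j * v j) = ∑ j, dz (μ i j) * v j + ∑ j, μ i j * dz (v j)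
    rw [map_sum, ← Finset.sum_add_distrib]
    exact Finset.sum_congr rfl fun j _ ↦ dz_mul _ _
  rw [h1, h1, h2, Matrix.mulVec_mulVec, Matrix.mulVec_add, Matrix.mulVec_mulVec, ← h,
    Matrix.add_mulVec]
  abel

theorem matOp_inv_comp_connection {μ : (Matrix (Fin n) (Fin n) K)ˣ}
    (h : mdz μ.val + B * μ = μ * L) :
    matOp (μ⁻¹).val ∘ₗ connection B ∘ₗ matOp μ.val = connection L := by
  refine LinearMap.ext fun v ↦ ?_
  change (μ⁻¹).val.mulVec (connection B (μ.val.mulVec v)) = _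
  rw [connection_mulVec h, Matrix.mulVec_mulVec, Units.inv_mul, Matrix.one_mulVec]

theorem stabilizes_map_Hplus (h : mdz μ + B * μ = μ * L)
    (hL : ∀ m : ℤ, 0 < m → cf m L = 0) : Stabilizes B ((Hplus n).map (matOp μ)) := by
  rintro _ ⟨p, hp, rfl⟩
  exact ⟨_, connection_mem_Hplus hL hp, (connection_mulVec h p).symm⟩

theorem projPlus_coeff (v : Fin n → K) (i : Fin n) (k : ℤ) :
    (projPlus v i).coeff k = if k < 1 then (v i).coeff k else 0 := rfl

theorem projPlus_mem_Hplus (v : Fin n → K) : projPlus v ∈ Hplus n := fun i k hk ↦ by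
  rw [projPlus_coeff, if_neg (by omega)]

theorem projPlus_add (u v : Fin n → K) : projPlus (u + v) = projPlus u + projPlus v :=
  funext fun i ↦ HahnSeries.truncLT_add _ (u i) (v i)

/-- `q` and the projection of `μ q` have the same leading term, so their difference has smaller
polynomial degree; induct on it. -/
theorem exists_projPlus_mulVec_eq (hμ : μ - 1 ∈ fil n 1) (t : ℕ) : ∀ q ∈ Hplus n,
    (∀ i, ∀ k < 1 - (t : ℤ), (q i).coeff k = 0) → ∃ p ∈ Hplus n, projPlus (μ.mulVec p) = q := by
  induction t with
  | zero =>
    intro q hq hqt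
    have : q = 0 := by
      ext i k
      rcases lt_or_ge 0 k with hk | hk
      · exact hq i k hk
      · exact hqt i k (by simpa using Int.lt_add_one_of_le hk)
    refine ⟨0, zero_mem _, ?_⟩
    rw [Matrix.mulVec_zero, this]
    ext i k
    rw [projPlus_coeff]
    split_ifs <;> rfl
  | succ t ih =>
    intro q hq hqt
    obtain ⟨p, hp, hpq⟩ := ih (q - projPlus (μ.mulVec q))
      (sub_mem hq (projPlus_mem_Hplus _)) fun i k hk ↦ by
        rw [Pi.sub_apply, HahnSeries.coeff_sub, projPlus_coeff, if_pos (by omega),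
          coeff_mulVec_eq hμ hqt (by push_cast; omega), sub_self]
    exact ⟨q + p, add_mem hq hp, by
      rw [Matrix.mulVec_add, projPlus_add, hpq, add_sub_cancel]⟩

theorem map_Hplus_mem_Gr (hμ : μ - 1 ∈ fil n 1) : (Hplus n).map (matOp μ) ∈ Gr n := by
  refine ⟨?_, fun v _ ↦ projPlus_mem_Hplus v, ?_, ?_⟩
  · rintro _ ⟨p, hp, rfl⟩
    exact ⟨z • p, z_smul_mem_Hplus hp, Matrix.mulVec_smul μ z p⟩
  · rintro _ ⟨p, hp, rfl⟩ _ ⟨q, hq, rfl⟩ hpq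
    have h : p - q = 0 := by
      ext i k
      rcases lt_or_ge 0 k with hk | hk
      · exact sub_mem hp hq i k hk
      · refine coeff_eq_zero_of_mulVec (N := 1) hμ (fun j m hm ↦ ?_) i k (by omega)
        have h1 := congrArg (fun x ↦ HahnSeries.coeff x m) (congrFun hpq j)
        simp only [projPlus_coeff, if_pos hm] at h1
        rw [Matrix.mulVec_sub, Pi.sub_apply, HahnSeries.coeff_sub]
        exact sub_eq_zero.mpr h1
    rw [sub_eq_zero.mp h]
  · intro q hq
    obtain ⟨c, hc⟩ := exists_forall_coeff_eq_zero q
    obtain ⟨p, hp, hpq⟩ := exists_projPlus_mulVec_eq hμ (1 - c).toNat q hq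
      fun i k hk ↦ hc i k (by omega)
    exact ⟨_, ⟨p, hp, rfl⟩, hpq⟩

end BigCell

/-! ### Homogeneous components of `X` and assembly of the theorem. -/

namespace CyclicGrading

section Main

variable {𝔤 : Type*} [LieRing 𝔤] [LieAlgebra ℂ 𝔤] (G : CyclicGrading 𝔤) {n : ℕ}
  {π : 𝔤 →ₗ⁅ℂ⁆ Matrix (Fin n) (Fin n) ℂ} {X : Matrix (Fin n) (Fin n) K}

theorem exists_act_eq {d : ℤ} (hX : X ∈ G.pfil π d) : ∃ x : HahnSeries ℤ 𝔤,
    act π x = X ∧ ∀ m, x.coeff m ∈ G.gle (d + G.h * m) := by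
  choose x hx hx' using hX
  refine ⟨HahnSeries.ofSuppBddBelow x ⟨-(|d| + 2), fun m hm ↦ ?_⟩,
    ext_cf fun m ↦ (cf_act π _ m).trans (hx' m).symm, hx⟩
  by_contra! h
  refine hm (G.eq_zero_of_mem_gle ?_ (hx m))
  have h1 := G.lt_of_abs_le d m (by
    rw [abs_of_neg (a := m) (by have := abs_nonneg d; omega)]; omega)
  have h2 := le_abs_self d
  have h3 := G.two_le_h
  have h4 := abs_nonneg d
  nlinarith

/-- The component of principal degree `d` of an element of the loop algebra. -/
def component (x : HahnSeries ℤ 𝔤) (d : ℤ) : HahnSeries ℤ 𝔤 :=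
  HahnSeries.ofSuppBddBelow (fun m ↦ G.P (d + G.h * m) (x.coeff m)) ⟨-(|d| + 2), fun m hm ↦ by
    by_contra! h
    exact hm (G.P_eq_zero_of_abs (G.lt_of_abs_le d m (by
      rw [abs_of_neg (a := m) (by have := abs_nonneg d; omega)]; omega)) _)⟩

theorem component_coeff (x : HahnSeries ℤ 𝔤) (d m : ℤ) :
    (G.component x d).coeff m = G.P (d + G.h * m) (x.coeff m) := rfl

theorem support_component_finite (x : HahnSeries ℤ 𝔤) (d : ℤ) :
    (G.component x d).support.Finite := by
  refine (Set.finite_Icc (-(|d| + 2)) (|d| + 2)).subset fun m hm ↦ ?_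
  rw [Set.mem_Icc, ← abs_le]
  by_contra! h
  exact hm (G.P_eq_zero_of_abs (G.lt_of_abs_le d m h.le) _)

/-- The sum runs through the degrees `c - 1, …, c - N`; the bound on `N` takes it down to `-h`,
where components vanish. With `c = h m` these are the components of principal degree `-1, …, -N` at
index `m`. -/
theorem sum_range_P {c : ℤ} {x : 𝔤} (hx : x ∈ G.gle (c - 1)) {N : ℕ} (hN : c + G.h ≤ N) :
    ∑ k ∈ Finset.range N, G.P (-(k + 1 : ℤ) + c) x = x := by
  have h1 : ∑ k ∈ Finset.range N, G.P (-(k + 1 : ℤ) + c) x =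
      ∑ f ∈ Finset.Ico (c - N) c, G.P f x := by
    refine Finset.sum_bij' (fun k _ ↦ -(k + 1 : ℤ) + c) (fun f _ ↦ (c - 1 - f).toNat)
      ?_ ?_ ?_ ?_ fun _ _ ↦ rfl
    · intro k hk; rw [Finset.mem_range] at hk; rw [Finset.mem_Ico]; omega
    · intro f hf; rw [Finset.mem_Ico] at hf; rw [Finset.mem_range]; omega
    · intro k _; omega
    · intro f hf; rw [Finset.mem_Ico] at hf; omega
  rw [h1]
  refine Eq.trans ?_ (G.sum_P x)
  rw [Finset.sum_subset (Finset.subset_union_left (s₂ := Finset.Ioo (-G.h) G.h)),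
    ← Finset.sum_subset (Finset.subset_union_right (s₁ := Finset.Ico (c - N) c))]
  · intro f _ hf
    rw [Finset.mem_Ioo] at hf
    exact G.P_of_le f x (by omega)
  · intro f _ hf
    rw [Finset.mem_Ico] at hf
    rcases lt_or_ge f c with h | h
    · exact G.P_of_le f x (Or.inl (by omega))
    · exact hx f (by omega)

theorem isFormalSum_component {x : HahnSeries ℤ 𝔤}
    (hx : ∀ m, x.coeff m ∈ G.gle (-G.h - 1 + G.h * m)) :
    IsFormalSum (fun k : ℕ ↦ G.component x (-(k + 1 : ℤ))) x := fun m ↦ by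
  filter_upwards [eventually_ge_atTop (G.h * m + G.h).toNat] with N hN
  rw [HahnSeries.coeff_sum]
  have h2 := G.two_le_h
  exact G.sum_range_P (G.gle_mono (by omega) (hx m)) (by omega)

theorem cf_lam_of_pos {m : ℤ} (hm : 0 < m) : cf m (G.lam π) = 0 := by
  rw [lam, map_add, cf_sgl, cf_sgl, if_neg (by omega), if_neg (by omega), add_zero]

/-- The dressing transformation that removes `H / z` from the connection. -/
theorem exists_gauge_transformation [FiniteDimensional ℂ 𝔤] [LieAlgebra.IsKilling ℂ 𝔤] {H : 𝔤}
    (hH : ⁅G.ρ, H⁆ = 0) : ∃ (x : HahnSeries ℤ 𝔤) (μ : (Matrix (Fin n) (Fin n) K)ˣ),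
      (∀ m, x.coeff m ∈ G.gle (-G.h - 1 + G.h * m)) ∧ (∀ m ≤ 0, x.coeff m = 0) ∧
      IsFormalExp (act π x) μ ∧ (μ : Matrix (Fin n) (Fin n) K) - 1 ∈ fil n 1 ∧
      mdz μ.val + (G.lam π + sgl 1 (π H)) * μ = μ * G.lam π := by
  have h2 := G.two_le_h
  obtain ⟨X, hX, hg⟩ := G.exists_dressing (π := π) hH
  obtain ⟨x, rfl, hx⟩ := G.exists_act_eq hX
  -- Principal degree at most `-h - 1` excludes all indices `m ≤ 0`; the exponential therefore
  -- converges `1/z`-adically.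
  have hX1 : act π x ∈ fil n 1 := G.pfil_le_fil (by omega) hX
  obtain ⟨μ, hμ, hμ'⟩ := exists_formalExp hX1
  have h1 : μ - 1 ∈ fil n 1 := by
    have := hμ' 1
    simpa [expSum] using this
  have hL : G.lam π ∈ fil n (-1) :=
    add_mem (fil_anti (by norm_num) (sgl_mem_fil _ _)) (sgl_mem_fil _ _)
  refine ⟨x, (isUnit_of_sub_one_mem_fil h1).unit, hx, fun m hm ↦
    G.eq_zero_of_mem_gle (by nlinarith) (hx m), hμ, h1, ?_⟩
  exact mdz_add_mul_eq (add_mem hL (fil_anti (by norm_num) (sgl_mem_fil _ _))) hL hX1 hμ' hg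

end Main

end CyclicGrading

end DrinfeldSokolov

end

theorem mainTheorem2 {𝔤 : Type*} [LieRing 𝔤] [LieAlgebra ℂ 𝔤] [FiniteDimensional ℂ 𝔤]
    [LieAlgebra.IsSimple ℂ 𝔤] (𝔥 : LieSubalgebra ℂ 𝔤) [𝔥.IsCartanSubalgebra]
    (b : (rootSystem 𝔥).Base) (c : DrinfeldSokolov.ChevalleyGenerators b)
    (θ : 𝔥.root) (hθ : DrinfeldSokolov.IsHighestRoot b θ)
    (E₀ : 𝔤) (hE₀ : E₀ ∈ rootSpace 𝔥 (-(θ.1 : 𝔥 → ℂ))) (hE₀_ne : E₀ ≠ 0)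
    {n : ℕ} (π : 𝔤 →ₗ⁅ℂ⁆ Matrix (Fin n) (Fin n) ℂ) (hπ : Function.Injective π) :
    (∀ H : 𝔥, ∃ (U : ℤ → HahnSeries ℤ 𝔤) (X : HahnSeries ℤ 𝔤)
        (μ : (Matrix (Fin n) (Fin n) DrinfeldSokolov.K)ˣ)
        (V : Submodule ℂ (Fin n → DrinfeldSokolov.K)),
      (∀ i < 0, DrinfeldSokolov.IsPrincipalDegree b θ i (U i)) ∧
      DrinfeldSokolov.IsFormalSum (fun k : ℕ ↦ U (-(k + 1 : ℤ))) X ∧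
      DrinfeldSokolov.IsFormalExp (DrinfeldSokolov.act π X) μ.val ∧
      DrinfeldSokolov.matOp (μ⁻¹).val ∘ₗ
          DrinfeldSokolov.connection (DrinfeldSokolov.act π
            (DrinfeldSokolov.overZ (H : 𝔤) + DrinfeldSokolov.cyclicElement c E₀)) ∘ₗ
          DrinfeldSokolov.matOp μ.val =
        DrinfeldSokolov.connection (DrinfeldSokolov.act π (DrinfeldSokolov.cyclicElement c E₀)) ∧
      V = (DrinfeldSokolov.Hplus n).map (DrinfeldSokolov.matOp μ.val) ∧
      V ∈ DrinfeldSokolov.bigCell π ∧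
      DrinfeldSokolov.Stabilizes (DrinfeldSokolov.act π
        (DrinfeldSokolov.overZ (H : 𝔤) + DrinfeldSokolov.cyclicElement c E₀)) V) ∧
    (∀ D : 𝔥, ∃ V ∈ DrinfeldSokolov.bigCell π,
      DrinfeldSokolov.Stabilizes (DrinfeldSokolov.act π
        (DrinfeldSokolov.overZ ((DrinfeldSokolov.coxeterNumber b θ : ℂ)⁻¹ •
            ((DrinfeldSokolov.rhoCheck b + D : 𝔥) : 𝔤)) +
          DrinfeldSokolov.cyclicElement c E₀)) V) := by
  open DrinfeldSokolov in
  have key (H : 𝔥) : ∃ (U : ℤ → HahnSeries ℤ 𝔤) (X : HahnSeries ℤ 𝔤)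
      (μ : (Matrix (Fin n) (Fin n) K)ˣ) (V : Submodule ℂ (Fin n → K)),
      (∀ i < 0, IsPrincipalDegree b θ i (U i)) ∧
      IsFormalSum (fun k : ℕ ↦ U (-(k + 1 : ℤ))) X ∧
      IsFormalExp (act π X) μ.val ∧
      matOp (μ⁻¹).val ∘ₗ connection (act π (overZ (H : 𝔤) + cyclicElement c E₀)) ∘ₗ
          matOp μ.val = connection (act π (cyclicElement c E₀)) ∧
      V = (Hplus n).map (matOp μ.val) ∧ V ∈ bigCell π ∧
      Stabilizes (act π (overZ (H : 𝔤) + cyclicElement c E₀)) V := by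
    let G : CyclicGrading 𝔤 := c.cyclicGrading hθ hE₀ hE₀_ne
    have hH : ⁅G.ρ, (H : 𝔤)⁆ = 0 := by
      have h := (mem_heightSpace b).mp (cartan_le_heightSpace b H.2)
      rw [Int.cast_zero, zero_smul] at h
      exact h
    obtain ⟨x, μ, hx, hx0, hμ, hμ1, h⟩ := G.exists_gauge_transformation (π := π) hH
    have hL : act π (cyclicElement c E₀) = G.lam π := by
      rw [cyclicElement, act_add, act_single, act_single]
      rfl
    have hB : act π (overZ (H : 𝔤) + cyclicElement c E₀) = G.lam π + sgl 1 (π H) := by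
      rw [act_add, hL, overZ, act_single, add_comm]
    rw [hB, hL]
    -- The same series `x` supplies the principal components and the element `A` witnessing
    -- membership in the big cell.
    refine ⟨G.component x, x, μ, _, fun i _ ↦ ⟨G.support_component_finite x i, fun m ↦ ?_⟩,
      G.isFormalSum_component hx, hμ, matOp_inv_comp_connection h, rfl,
      ⟨map_Hplus_mem_Gr hμ1, x, μ, hx0, hμ, rfl⟩,
      stabilizes_map_Hplus h fun m hm ↦ G.cf_lam_of_pos hm⟩
    have h1 := G.lie_P (i + G.h * -m) (x.coeff (-m))
    rw [mul_neg, ← sub_eq_add_neg] at h1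
    rw [G.component_coeff, mul_neg, ← sub_eq_add_neg]
    exact h1
  refine ⟨key, fun D ↦ ?_⟩
  obtain ⟨_, _, _, V, -, -, -, -, -, hV, hS⟩ :=
    key ((DrinfeldSokolov.coxeterNumber b θ : ℂ)⁻¹ • (DrinfeldSokolov.rhoCheck b + D))
  exact ⟨V, hV, hS⟩
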